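/- For a bounded interval $I$ of positive length and $\varphi\in L^1(I)$ real-valued, write $\langle\varphi\rangle_J=\frac1{|J|}\int_J\varphi$ for subintervals $J\subset I$ of positive length, and let $$\|\varphi\|_{\mathrm{BMO}(I)}=\Bigl(\sup_{J\subset I}\langle|\varphi-\langle\varphi\rangle_J|^2\rangle_J\Bigr)^{1/2},$$ the supremum being over all such $J$. For $\varepsilon\ge0$ let $\mathrm{BMO}_\varepsilon(I)=\{\varphi\in L^1(I):\|\varphi\|_{\mathrm{BMO}(I)}\le\varepsilon\}$ and $\Omega_\varepsilon=\{x=(x_1,x_2)\in\mathbb R^2:\ x_1^2\le x_2\le x_1^2+\varepsilon^2\}$. For $x\in\Omega_\varepsilon$ define, with values in $[0,+\infty]$, $$\mathbf B^+_\varepsilon(x)=\sup\{\langle e^\varphi\rangle_I\},\qquad \mathbf B^-_\varepsilon(x)=\inf\{\langle e^\varphi\rangle_I\},$$ both taken over all $\varphi\in\mathrm{BMO}_\varepsilon(I)$ with $\langle\varphi\rangle_I=x_1$ and $\langle\varphi^2\rangle_I=x_2$. Then, for every such interval $I$, every $\varepsilon\ge0$ and every $x\in\Omega_\varepsilon$: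 1. if $0\le\varepsilon<1$, then $$\mathbf B^+_\varepsilon(x)=\frac{1-\sqrt{\varepsilon^2+x_1^2-x_2}}{1-\varepsilon}\exp\Bigl(x_1+\sqrt{\varepsilon^2+x_1^2-x_2}-\varepsilon\Bigr);$$ 2. if $\varepsilon\ge1$, then $\mathbf B^+_\varepsilon(x)=e^{x_1}$ when $x_2=x_1^2$, and $\mathbf B^+_\varepsilon(x)=+\infty$ when $x_2>x_1^2$; 3. for all $\varepsilon\ge0$, $$\mathbf B^-_\varepsilon(x)=\frac{1+\sqrt{\varepsilon^2+x_1^2-x_2}}{1+\varepsilon}\exp\Bigl(x_1-\sqrt{\varepsilon^2+x_1^2-x_2}+\varepsilon\Bigr).$$ -/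

import Mathlib

open MeasureTheory
open scoped ENNReal

/-- The `L²`-based BMO norm of `φ` on the interval `I = [a, b]`, with values in `[0, ∞]`: the square
root of the supremum, over all nondegenerate subintervals `J = [c, d]` of `I`, of the average over
`J` of `|φ - ⟨φ⟩_J|²`. -/
noncomputable def bmoNorm (a b : ℝ) (φ : ℝ → ℝ) : ℝ≥0∞ :=
  (⨆ (c : ℝ) (d : ℝ) (_ : a ≤ c ∧ c < d ∧ d ≤ b),
    ⨍⁻ s, ‖φ s - ⨍ t in Set.Icc c d, φ t‖ₑ ^ 2 ∂(volume.restrict (Set.Icc c d))) ^ (1 / 2 : ℝ)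

/-- The space `BMO(I)`, `I = [a, b]`: integrable functions on `I` with finite norm. The values of
`φ` outside `I` play no role. -/
def BMO (a b : ℝ) : Set (ℝ → ℝ) :=
  {φ | IntegrableOn φ (Set.Icc a b) ∧ bmoNorm a b φ < ∞}

/-- The closed ball of radius `ε` around `0` in `BMO(I)`, `I = [a, b]`. -/
def bmoBall (ε a b : ℝ) : Set (ℝ → ℝ) :=
  {φ | φ ∈ BMO a b ∧ bmoNorm a b φ ≤ ENNReal.ofReal ε}

/-- The domain `Ω_ε = {x : x₁² ≤ x₂ ≤ x₁² + ε²}`. -/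
def bellmanDomain (ε : ℝ) : Set (ℝ × ℝ) :=
  {x | x.1 ^ 2 ≤ x.2 ∧ x.2 ≤ x.1 ^ 2 + ε ^ 2}

/-- The functions `φ` in the `ε`-ball of `BMO(I)`, `I = [a, b]`, with `⟨φ⟩_I = x₁` and
`⟨φ²⟩_I = x₂`. Such `φ` are square integrable on `I`, so both averages are genuine. -/
def bellmanAdmissible (ε a b : ℝ) (x : ℝ × ℝ) : Set (ℝ → ℝ) :=
  {φ | φ ∈ bmoBall ε a b ∧
    (⨍ s in Set.Icc a b, φ s) = x.1 ∧ (⨍ s in Set.Icc a b, φ s ^ 2) = x.2}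

/-- The average `⟨e^φ⟩_I`, `I = [a, b]`, with values in `[0, ∞]`. -/
noncomputable def expAverage (a b : ℝ) (φ : ℝ → ℝ) : ℝ≥0∞ :=
  ⨍⁻ s, ENNReal.ofReal (Real.exp (φ s)) ∂(volume.restrict (Set.Icc a b))

/-- The upper Bellman function, a supremum in `[0, ∞]`. -/
noncomputable def bellmanUpper (ε a b : ℝ) (x : ℝ × ℝ) : ℝ≥0∞ :=
  ⨆ φ ∈ bellmanAdmissible ε a b x, expAverage a b φ

/-- The lower Bellman function, an infimum in `[0, ∞]`. -/
noncomputable def bellmanLower (ε a b : ℝ) (x : ℝ × ℝ) : ℝ≥0∞ :=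
  ⨅ φ ∈ bellmanAdmissible ε a b x, expAverage a b φ

/-- The explicit function `B⁺_δ`; it is positive on `bellmanDomain δ` for `0 ≤ δ < 1`. -/
noncomputable def explicitUpper (δ : ℝ) (x : ℝ × ℝ) : ℝ :=
  (1 - √(δ ^ 2 + x.1 ^ 2 - x.2)) / (1 - δ) *
    Real.exp (x.1 + √(δ ^ 2 + x.1 ^ 2 - x.2) - δ)

/-- The explicit function `B⁻_δ`; it is positive for `0 ≤ δ`. -/
noncomputable def explicitLower (δ : ℝ) (x : ℝ × ℝ) : ℝ :=
  (1 + √(δ ^ 2 + x.1 ^ 2 - x.2)) / (1 + δ) *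
    Real.exp (x.1 - √(δ ^ 2 + x.1 ^ 2 - x.2) + δ)

/-! Attach to each subinterval `J` the point `(⟨φ⟩_J, ⟨φ²⟩_J)`. Cauchy–Schwarz and the BMO bound
place it in the strip `Ω_ε`. If `B` is concave along segments in the strip and `B (u, u²) = e^u`,
then cutting `I` repeatedly can only decrease the weighted sum of the values of `B`. As the pieces
shrink, that sum tends to `⟨e^φ⟩_I`, so `⟨e^φ⟩_I ≤ B x`.

The obstacle is that the strip is not convex: the segment joining the points of the two pieces may
leave it. `exists_split` chooses each cut so that the segment stays in a slightly wider strip and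
neither piece is too long. The explicit function of a still larger parameter is concave along such
segments, since its second derivative has a sign (`concaveOn_mul_exp_along`). This yields
`bellman_induction` for bounded `φ`. Truncation removes boundedness, and the parameter then
decreases to `ε`. The lower bound is the same argument for `-B⁻`.

For sharpness, `log` has variance at most `1` on every interval, so a constant plus `σ = ± ε` times
a truncated logarithm is admissible. These functions attain both bounds (`σ = ε` above, `σ = -ε`
below). When `σ = ε ≥ 1` the exponential behaves like `t^(-σ)` at the singularity and is not
integrable, whence the value `+∞`. On the lower parabola `φ` is constant almost everywhere. -/

open Filter Topology

/-! ### Averages, variances and the BMO ball. -/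

/-- The average of `f` over `[c, d]`, as a normalised interval integral. -/
noncomputable def iavg (f : ℝ → ℝ) (c d : ℝ) : ℝ := (d - c)⁻¹ * ∫ t in c..d, f t

theorem setAverage_Icc_eq_iavg (f : ℝ → ℝ) {c d : ℝ} (h : c < d) :
    (⨍ t in Set.Icc c d, f t) = iavg f c d := by
  rw [setAverage_eq, iavg, intervalIntegral.integral_of_le h.le, integral_Icc_eq_integral_Ioc]
  simp [Measure.real, h.le]

theorem laverage_Icc_eq (f : ℝ → ℝ≥0∞) {c d : ℝ} :
    (⨍⁻ t, f t ∂(volume.restrict (Set.Icc c d))) =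
      (∫⁻ t in Set.Icc c d, f t) / ENNReal.ofReal (d - c) := by
  rw [laverage_eq]
  simp

theorem laverage_Icc_ofReal {f : ℝ → ℝ} {c d : ℝ} (h : c < d)
    (hf : IntegrableOn f (Set.Icc c d)) (h0 : ∀ t, 0 ≤ f t) :
    (⨍⁻ t, ENNReal.ofReal (f t) ∂(volume.restrict (Set.Icc c d))) =
      ENNReal.ofReal (iavg f c d) := by
  rw [laverage_Icc_eq, iavg, intervalIntegral.integral_of_le h.le,
    ← integral_Icc_eq_integral_Ioc, ← ofReal_integral_eq_lintegral_ofReal hf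
      (Filter.Eventually.of_forall h0), ← ENNReal.ofReal_div_of_pos (sub_pos.2 h), div_eq_inv_mul]

theorem MeasureTheory.IntegrableOn.intervalIntegrable_of_subset {f : ℝ → ℝ} {a b c d : ℝ}
    (hf : IntegrableOn f (Set.Icc a b)) (hac : a ≤ c) (hcd : c ≤ d) (hdb : d ≤ b) :
    IntervalIntegrable f volume c d := by
  rw [intervalIntegrable_iff_integrableOn_Icc_of_le hcd]
  exact hf.mono_set (Set.Icc_subset_Icc hac hdb)

theorem iavg_congr {f g : ℝ → ℝ} {c d : ℝ} (hcd : c ≤ d)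
    (h : ∀ t ∈ Set.Ioc c d, f t = g t) : iavg f c d = iavg g c d := by
  rw [iavg, iavg, intervalIntegral.integral_of_le hcd, intervalIntegral.integral_of_le hcd,
    setIntegral_congr_fun measurableSet_Ioc h]

theorem iavg_mono {f g : ℝ → ℝ} {c d : ℝ} (hcd : c ≤ d)
    (hf : IntervalIntegrable f volume c d) (hg : IntervalIntegrable g volume c d)
    (h : ∀ t, f t ≤ g t) : iavg f c d ≤ iavg g c d :=
  mul_le_mul_of_nonneg_left (intervalIntegral.integral_mono hcd hf hg h)
    (inv_nonneg.2 (sub_nonneg.2 hcd))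

theorem iavg_const (k : ℝ) {c d : ℝ} (hcd : c < d) : iavg (fun _ => k) c d = k := by
  have : d - c ≠ 0 := (sub_pos.2 hcd).ne'
  simp only [iavg, intervalIntegral.integral_const, smul_eq_mul]
  field_simp

theorem iavg_const_add_mul {f : ℝ → ℝ} (k l : ℝ) {c d : ℝ} (hcd : c < d)
    (hf : IntervalIntegrable f volume c d) :
    iavg (fun t => k + l * f t) c d = k + l * iavg f c d := by
  have : d - c ≠ 0 := (sub_pos.2 hcd).ne'
  rw [iavg, iavg, intervalIntegral.integral_add (by simp) (hf.const_mul l),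
    intervalIntegral.integral_const_mul, intervalIntegral.integral_const, smul_eq_mul]
  field_simp

theorem iavg_quadratic {f : ℝ → ℝ} (k l m : ℝ) {c d : ℝ} (hcd : c < d)
    (hf : IntervalIntegrable f volume c d) (hf2 : IntervalIntegrable (fun t => f t ^ 2) volume c d) :
    iavg (fun t => k + l * f t + m * f t ^ 2) c d =
      k + l * iavg f c d + m * iavg (fun t => f t ^ 2) c d := by
  have : d - c ≠ 0 := (sub_pos.2 hcd).ne'
  rw [iavg, iavg, iavg, intervalIntegral.integral_add ((by simp : IntervalIntegrable _ _ _ _).add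
    (hf.const_mul l)) (hf2.const_mul m),
    intervalIntegral.integral_add (by simp) (hf.const_mul l),
    intervalIntegral.integral_const_mul, intervalIntegral.integral_const_mul,
    intervalIntegral.integral_const, smul_eq_mul]
  field_simp

theorem iavg_sub_sq {f : ℝ → ℝ} (k : ℝ) {c d : ℝ} (hcd : c < d)
    (hf : IntervalIntegrable f volume c d) (hf2 : IntervalIntegrable (fun t => f t ^ 2) volume c d) :
    iavg (fun t => (f t - k) ^ 2) c d =
      iavg (fun t => f t ^ 2) c d - 2 * k * iavg f c d + k ^ 2 := by
  have h := iavg_quadratic (k ^ 2) (-2 * k) 1 hcd hf hf2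
  have e : (fun t => (f t - k) ^ 2) = fun t => k ^ 2 + -2 * k * f t + 1 * f t ^ 2 := by
    funext t; ring
  rw [e, h]; ring

theorem sq_iavg_le {f : ℝ → ℝ} {c d : ℝ} (hcd : c < d)
    (hf : IntervalIntegrable f volume c d) (hf2 : IntervalIntegrable (fun t => f t ^ 2) volume c d) :
    iavg f c d ^ 2 ≤ iavg (fun t => f t ^ 2) c d := by
  have h := iavg_sub_sq (iavg f c d) hcd hf hf2
  have : 0 ≤ iavg (fun t => (f t - iavg f c d) ^ 2) c d :=
    mul_nonneg (inv_nonneg.2 (sub_nonneg.2 hcd.le))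
      (intervalIntegral.integral_nonneg hcd.le fun t _ => sq_nonneg _)
  nlinarith

/-- Square integrable functions on `[a, b]` whose variance over every subinterval is at most
`ε ^ 2`. -/
structure VarianceBounded (ε a b : ℝ) (φ : ℝ → ℝ) : Prop where
  integrable : IntegrableOn φ (Set.Icc a b)
  integrable_sq : IntegrableOn (fun t => φ t ^ 2) (Set.Icc a b)
  variance_le : ∀ c d, a ≤ c → c < d → d ≤ b →
    iavg (fun t => φ t ^ 2) c d ≤ iavg φ c d ^ 2 + ε ^ 2

theorem bmoNorm_le_iff {ε a b : ℝ} {φ : ℝ → ℝ} :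
    bmoNorm a b φ ≤ ENNReal.ofReal ε ↔ ∀ c d, a ≤ c → c < d → d ≤ b →
      (⨍⁻ s, ‖φ s - ⨍ t in Set.Icc c d, φ t‖ₑ ^ 2 ∂(volume.restrict (Set.Icc c d))) ≤
        ENNReal.ofReal ε ^ 2 := by
  rw [bmoNorm, one_div, ENNReal.rpow_inv_le_iff two_pos]
  simp only [iSup_le_iff, and_imp]
  norm_cast

theorem enorm_sub_sq (x y : ℝ) : ‖x - y‖ₑ ^ 2 = ENNReal.ofReal ((x - y) ^ 2) := by
  rw [← ofReal_norm, ← ENNReal.ofReal_pow (norm_nonneg _), Real.norm_eq_abs, sq_abs]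

theorem integrableOn_sub_sq {φ : ℝ → ℝ} {s : Set ℝ} (hs : volume s ≠ ∞) (k : ℝ)
    (h1 : IntegrableOn φ s) (h2 : IntegrableOn (fun t => φ t ^ 2) s) :
    IntegrableOn (fun t => (φ t - k) ^ 2) s := by
  have e : (fun t => (φ t - k) ^ 2) = fun t => φ t ^ 2 + -2 * k * φ t + k ^ 2 := by
    funext t; ring
  rw [e]
  exact (h2.add (h1.const_mul _)).add (integrableOn_const hs)

theorem laverage_variance {φ : ℝ → ℝ} {c d : ℝ} (hcd : c < d)
    (h1 : IntegrableOn φ (Set.Icc c d)) (h2 : IntegrableOn (fun t => φ t ^ 2) (Set.Icc c d)) :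
    (⨍⁻ s, ‖φ s - ⨍ t in Set.Icc c d, φ t‖ₑ ^ 2 ∂(volume.restrict (Set.Icc c d))) =
      ENNReal.ofReal (iavg (fun t => φ t ^ 2) c d - iavg φ c d ^ 2) := by
  simp only [enorm_sub_sq]
  rw [laverage_Icc_ofReal hcd (integrableOn_sub_sq (by simp) _ h1 h2) fun t => sq_nonneg _,
    setAverage_Icc_eq_iavg _ hcd, iavg_sub_sq _ hcd
      (h1.intervalIntegrable_of_subset le_rfl hcd.le le_rfl)
      (h2.intervalIntegrable_of_subset le_rfl hcd.le le_rfl)]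
  congr 1; ring

/-- The bound on the whole interval `[a, b]` already forces square integrability; after that, mean
square deviation is `⟨φ²⟩ - ⟨φ⟩²` and the norm bound can be read in real numbers. -/
theorem mem_bmoBall_iff {ε a b : ℝ} (hε : 0 ≤ ε) (hab : a < b) {φ : ℝ → ℝ} :
    φ ∈ bmoBall ε a b ↔ VarianceBounded ε a b φ := by
  constructor
  · rintro ⟨⟨h1, -⟩, hn⟩
    rw [bmoNorm_le_iff] at hn
    have h2 : IntegrableOn (fun t => φ t ^ 2) (Set.Icc a b) := by
      have h := hn a b le_rfl hab le_rfl
      set k := ⨍ t in Set.Icc a b, φ t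
      simp only [enorm_sub_sq] at h
      have hI : IntegrableOn (fun t => (φ t - k) ^ 2) (Set.Icc a b) := by
        refine ⟨((h1.aestronglyMeasurable.sub aestronglyMeasurable_const).pow 2), ?_⟩
        rw [hasFiniteIntegral_iff_ofReal (Filter.Eventually.of_forall fun t => sq_nonneg _)]
        rw [laverage_Icc_eq] at h
        have h3 := lt_of_le_of_lt h (ENNReal.pow_lt_top ENNReal.ofReal_lt_top)
        by_contra hc
        rw [not_lt, top_le_iff] at hc
        rw [hc, ENNReal.top_div_of_ne_top ENNReal.ofReal_ne_top] at h3
        exact lt_irrefl _ h3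
      have e : (fun t => φ t ^ 2) = fun t => (φ t - k) ^ 2 + 2 * k * φ t + - k ^ 2 := by
        funext t; ring
      rw [e]
      exact (hI.add (h1.const_mul _)).add (integrableOn_const (by simp))
    refine ⟨h1, h2, fun c d hac hcd hdb => ?_⟩
    have h := hn c d hac hcd hdb
    rw [laverage_variance hcd (h1.mono_set (Set.Icc_subset_Icc hac hdb))
      (h2.mono_set (Set.Icc_subset_Icc hac hdb)), ← ENNReal.ofReal_pow hε,
      ENNReal.ofReal_le_ofReal_iff (sq_nonneg _)] at h
    linarith
  · rintro ⟨h1, h2, h⟩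
    have hn : bmoNorm a b φ ≤ ENNReal.ofReal ε := by
      rw [bmoNorm_le_iff]
      intro c d hac hcd hdb
      rw [laverage_variance hcd (h1.mono_set (Set.Icc_subset_Icc hac hdb))
        (h2.mono_set (Set.Icc_subset_Icc hac hdb)), ← ENNReal.ofReal_pow hε]
      exact ENNReal.ofReal_le_ofReal (by linarith [h c d hac hcd hdb])
    exact ⟨⟨h1, hn.trans_lt ENNReal.ofReal_lt_top⟩, hn⟩

theorem mem_bellmanAdmissible_iff {ε a b : ℝ} (hε : 0 ≤ ε) (hab : a < b) {x : ℝ × ℝ}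
    {φ : ℝ → ℝ} : φ ∈ bellmanAdmissible ε a b x ↔
      VarianceBounded ε a b φ ∧ iavg φ a b = x.1 ∧ iavg (fun t => φ t ^ 2) a b = x.2 := by
  rw [bellmanAdmissible, Set.mem_ofPred_eq, mem_bmoBall_iff hε hab, setAverage_Icc_eq_iavg _ hab,
    setAverage_Icc_eq_iavg _ hab]

namespace VarianceBounded

variable {ε a b : ℝ} {φ : ℝ → ℝ}

theorem intervalIntegrable (h : VarianceBounded ε a b φ) {c d : ℝ} (hac : a ≤ c) (hcd : c ≤ d)
    (hdb : d ≤ b) : IntervalIntegrable φ volume c d :=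
  h.integrable.intervalIntegrable_of_subset hac hcd hdb

theorem intervalIntegrable_sq (h : VarianceBounded ε a b φ) {c d : ℝ} (hac : a ≤ c) (hcd : c ≤ d)
    (hdb : d ≤ b) : IntervalIntegrable (fun t => φ t ^ 2) volume c d :=
  h.integrable_sq.intervalIntegrable_of_subset hac hcd hdb

/-- Composing with a `1`-Lipschitz function does not increase variances. -/
theorem comp_lipschitz (h : VarianceBounded ε a b φ) {T : ℝ → ℝ} (hT : LipschitzWith 1 T) :
    VarianceBounded ε a b (fun t => T (φ t)) := by
  have hle : ∀ x y, (T x - T y) ^ 2 ≤ (x - y) ^ 2 := fun x y => by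
    have := hT.dist_le_mul x y
    rw [Real.dist_eq, Real.dist_eq, NNReal.coe_one, one_mul] at this
    exact sq_le_sq.2 this
  have hm : AEStronglyMeasurable (fun t => T (φ t)) (volume.restrict (Set.Icc a b)) :=
    hT.continuous.comp_aestronglyMeasurable h.integrable.aestronglyMeasurable
  have hI2 : IntegrableOn (fun t => (T (φ t) - T 0) ^ 2) (Set.Icc a b) := by
    refine h.integrable_sq.mono' ((hm.sub aestronglyMeasurable_const).pow 2)
      (Filter.Eventually.of_forall fun t => ?_)
    rw [Real.norm_of_nonneg (sq_nonneg _)]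
    simpa using hle (φ t) 0
  have hI1' : IntegrableOn (fun t => T (φ t) - T 0) (Set.Icc a b) := by
    refine h.integrable.abs.mono' (hm.sub aestronglyMeasurable_const)
      (Filter.Eventually.of_forall fun t => ?_)
    simpa using sq_le_sq.1 (hle (φ t) 0)
  have hI1 : IntegrableOn (fun t => T (φ t)) (Set.Icc a b) := by
    have := hI1'.add (integrableOn_const (C := T 0) (s := Set.Icc a b) (μ := volume) (by simp))
    refine this.congr_fun (fun t _ => ?_) measurableSet_Icc
    simp
  have hI2' : IntegrableOn (fun t => T (φ t) ^ 2) (Set.Icc a b) := by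
    have := integrableOn_sub_sq (s := Set.Icc a b) (by simp) (-T 0) hI1' hI2
    refine this.congr_fun (fun t _ => ?_) measurableSet_Icc
    simp
  refine ⟨hI1, hI2', fun c d hac hcd hdb => ?_⟩
  have i1 := hI1.intervalIntegrable_of_subset hac hcd.le hdb
  have i2 := hI2'.intervalIntegrable_of_subset hac hcd.le hdb
  have j1 := h.intervalIntegrable hac hcd.le hdb
  have j2 := h.intervalIntegrable_sq hac hcd.le hdb
  have hs : Set.Icc c d ⊆ Set.Icc a b := Set.Icc_subset_Icc hac hdb
  -- The variance of `T ∘ φ` is at most its mean square deviation from any constant; the constant `T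
  -- ⟨φ⟩` allows a pointwise comparison.
  have key := iavg_mono hcd.le
    ((integrableOn_sub_sq (by simp) (T (iavg φ c d)) hI1 hI2').intervalIntegrable_of_subset
      hac hcd.le hdb)
    ((integrableOn_sub_sq (by simp) (iavg φ c d) h.integrable
      h.integrable_sq).intervalIntegrable_of_subset hac hcd.le hdb) fun t => hle (φ t) (iavg φ c d)
  rw [iavg_sub_sq _ hcd i1 i2, iavg_sub_sq _ hcd j1 j2] at key
  nlinarith [h.variance_le c d hac hcd hdb,
    sq_nonneg (iavg (fun t => T (φ t)) c d - T (iavg φ c d))]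

theorem const_add_mul (h : VarianceBounded ε a b φ) (k l : ℝ) :
    VarianceBounded (l * ε) a b (fun t => k + l * φ t) := by
  have hI1 : IntegrableOn (fun t => k + l * φ t) (Set.Icc a b) :=
    (integrableOn_const (by simp)).add (h.integrable.const_mul l)
  have e : (fun t => (k + l * φ t) ^ 2) = fun t => k ^ 2 + (2 * k * l) * φ t + l ^ 2 * φ t ^ 2 := by
    funext t; ring
  refine ⟨hI1, ?_, fun c d hac hcd hdb => ?_⟩
  · rw [e]
    exact ((integrableOn_const (by simp)).add (h.integrable.const_mul _)).add
      (h.integrable_sq.const_mul _)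
  · have j1 := h.intervalIntegrable hac hcd.le hdb
    have j2 := h.intervalIntegrable_sq hac hcd.le hdb
    rw [e, iavg_quadratic _ _ _ hcd j1 j2, iavg_const_add_mul _ _ hcd j1]
    nlinarith [mul_le_mul_of_nonneg_left (h.variance_le c d hac hcd hdb) (sq_nonneg l)]

end VarianceBounded

/-! ### Cutting an interval without leaving a wider strip. -/

/-- The vertical distance from the point `(1 - θ) • y + θ • z` to the parabola `x₂ = x₁²`. -/
def parabolaExcess (y z : ℝ × ℝ) (θ : ℝ) : ℝ :=
  (1 - θ) * y.2 + θ * z.2 - ((1 - θ) * y.1 + θ * z.1) ^ 2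

/-- The segment from `y` to `z` stays below the upper boundary of `bellmanDomain δ`. -/
def SegmentBelow (δ : ℝ) (y z : ℝ × ℝ) : Prop :=
  ∀ θ ∈ Set.Icc (0 : ℝ) 1, parabolaExcess y z θ ≤ δ ^ 2

theorem parabolaExcess_swap (y z : ℝ × ℝ) (θ : ℝ) :
    parabolaExcess y z (1 - θ) = parabolaExcess z y θ := by
  simp only [parabolaExcess]; ring

theorem SegmentBelow.symm {δ : ℝ} {y z : ℝ × ℝ} (h : SegmentBelow δ y z) :
    SegmentBelow δ z y := fun θ hθ => by
  rw [← parabolaExcess_swap]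
  exact h _ ⟨by linarith [hθ.2], by linarith [hθ.1]⟩

/-- The point `x` lies on the segment from `y` to `z`, which is therefore the union of the segments
from `x` to its ends. -/
theorem SegmentBelow.trans {δ : ℝ} {x y z : ℝ × ℝ} {τ : ℝ} (hτ : τ ∈ Set.Ioo (0 : ℝ) 1)
    (h1 : x.1 = (1 - τ) * y.1 + τ * z.1) (h2 : x.2 = (1 - τ) * y.2 + τ * z.2)
    (hy : SegmentBelow δ x y) (hz : SegmentBelow δ x z) : SegmentBelow δ y z := fun θ hθ => by
  have t0 := hτ.1
  have t1 : 0 < 1 - τ := by linarith [hτ.2]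
  rcases le_total θ τ with h | h
  · have e : parabolaExcess y z θ = parabolaExcess x y (1 - θ / τ) := by
      simp only [parabolaExcess, h1, h2]; field_simp; ring
    rw [e]
    refine hy _ ⟨?_, ?_⟩
    · rw [sub_nonneg, div_le_one t0]; exact h
    · linarith [div_nonneg hθ.1 t0.le]
  · have e : parabolaExcess y z θ = parabolaExcess x z ((θ - τ) / (1 - τ)) := by
      simp only [parabolaExcess, h1, h2]; field_simp; ring
    rw [e]
    refine hz _ ⟨div_nonneg (by linarith) t1.le, ?_⟩
    rw [div_le_one t1]; linarith [hθ.2]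

/-- If the segment from `x` to `f` touches the upper parabola from below, then the whole line
through `x` and `f` stays below that parabola, and `x` cannot be too close to `f`. -/
theorem segmentBelow_of_tangent {ε δ τ : ℝ} (hδ : 0 < δ) (hεδ : ε ^ 2 < δ ^ 2)
    {x f g : ℝ × ℝ} (hτ : τ ∈ Set.Ioc (0 : ℝ) (1 / 2))
    (h1 : x.1 = (1 - τ) * f.1 + τ * g.1) (h2 : x.2 = (1 - τ) * f.2 + τ * g.2)
    (hx : x.2 ≤ x.1 ^ 2 + ε ^ 2) (hf : f.2 ≤ f.1 ^ 2 + ε ^ 2) (hg : g.1 ^ 2 ≤ g.2)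
    (hs : SegmentBelow δ x f) (ht : ∃ θ ∈ Set.Icc (0 : ℝ) 1, parabolaExcess x f θ = δ ^ 2) :
    √(δ ^ 2 - ε ^ 2) / δ ≤ τ ∧ SegmentBelow δ f g := by
  obtain ⟨θ₀, hθ₀, ht⟩ := ht
  have t0 := hτ.1
  have l0 : 0 < θ₀ := by
    refine lt_of_le_of_ne hθ₀.1 fun h => ?_
    subst h
    simp [parabolaExcess] at ht
    linarith
  have l1 : θ₀ < 1 := by
    refine lt_of_le_of_ne hθ₀.2 fun h => ?_
    subst h
    simp [parabolaExcess] at ht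
    linarith
  have hd : HasDerivAt (parabolaExcess x f)
      (-x.2 + f.2 - 2 * ((1 - θ₀) * x.1 + θ₀ * f.1) * (f.1 - x.1)) θ₀ := by
    have i1 : HasDerivAt (fun θ : ℝ => 1 - θ) (-1) θ₀ := by
      simpa using (hasDerivAt_id θ₀).const_sub 1
    have i2 : HasDerivAt (fun θ : ℝ => θ) 1 θ₀ := hasDerivAt_id θ₀
    have := ((i1.mul_const x.2).add (i2.mul_const f.2)).sub
      (((i1.mul_const x.1).add (i2.mul_const f.1)).pow 2)
    refine this.congr_deriv ?_
    simp only [Pi.add_apply, Nat.cast_ofNat, show (2 - 1 : ℕ) = 1 from rfl, pow_one]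
    ring
  have hmax : IsLocalMax (parabolaExcess x f) θ₀ := by
    filter_upwards [Icc_mem_nhds l0 l1] with θ hθ
    rw [ht]; exact hs θ hθ
  have hd0 := hmax.hasDerivAt_eq_zero hd
  -- The excess is quadratic in `θ` with leading coefficient `-(f.1 - x.1)²`, and it has a critical
  -- point at `θ₀` with value `δ²`.
  have key : ∀ θ, parabolaExcess x f θ = δ ^ 2 - ((f.1 - x.1) * (θ - θ₀)) ^ 2 := fun θ => by
    rw [← ht]
    simp only [parabolaExcess]
    linear_combination (θ - θ₀) * hd0
  -- The point `g` lies on the line through `x` and `f`, at parameter `-(1 - τ) / τ`.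
  have hfg : ∀ θ, parabolaExcess f g θ = parabolaExcess x f (1 - θ - θ * ((1 - τ) / τ)) := fun θ => by
    simp only [parabolaExcess, h1, h2]; field_simp; ring
  constructor
  -- Both `x` and `f` have excess at most `ε²`, so each is at horizontal distance at least `r` from
  -- the tangency point and `2 r ≤ q`. The excess of `g` is nonnegative, so its distance is at most
  -- `δ`, giving `q (1 - τ) ≤ δ τ`. As `1 - τ ≥ 1 / 2`, it follows that `r ≤ δ τ`.
  · set r := √(δ ^ 2 - ε ^ 2) with hr
    have hr2 : r ^ 2 = δ ^ 2 - ε ^ 2 := Real.sq_sqrt (by linarith)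
    have hr0 : 0 ≤ r := Real.sqrt_nonneg _
    set q := |f.1 - x.1| with hq
    have hq0 : 0 ≤ q := abs_nonneg _
    have k0 := key 0
    have k1 := key 1
    have k2 := hfg 1
    rw [key] at k2
    simp only [parabolaExcess] at k0 k1 k2
    have m0 : r ≤ q * θ₀ := by
      refine (pow_le_pow_iff_left₀ hr0 (by positivity) two_ne_zero).1 ?_
      rw [mul_pow, hq, sq_abs]; linarith
    have m1 : r ≤ q * (1 - θ₀) := by
      refine (pow_le_pow_iff_left₀ hr0 (mul_nonneg hq0 (by linarith)) two_ne_zero).1 ?_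
      rw [mul_pow, hq, sq_abs]; linarith
    have hρ : 0 ≤ (1 - τ) / τ := div_nonneg (by linarith [hτ.2]) t0.le
    have m2 : q * ((1 - τ) / τ + θ₀) ≤ δ := by
      refine (pow_le_pow_iff_left₀ (by positivity) hδ.le two_ne_zero).1 ?_
      rw [mul_pow, hq, sq_abs]; linarith
    have m3 : q * ((1 - τ) / τ) ≤ δ := by linarith [mul_nonneg hq0 l0.le]
    rw [← mul_div_assoc, div_le_iff₀ t0] at m3
    rw [div_le_iff₀ hδ]
    have m4 : q * (1 / 2) ≤ q * (1 - τ) := mul_le_mul_of_nonneg_left (by linarith [hτ.2]) hq0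
    linarith
  · intro θ _
    rw [hfg, key]
    linarith [sq_nonneg ((f.1 - x.1) * (1 - θ - θ * ((1 - τ) / τ) - θ₀))]

/-- The maximal excess on the segment from `x` to `f τ` is continuous in `τ`, at most `δ²` at `0`
and at least `δ²` at `1 / 2`. By the intermediate value theorem some segment touches the upper
parabola, and `segmentBelow_of_tangent` applies to it. -/
theorem exists_tangent {ε δ : ℝ} (hδ : 0 < δ) (hεδ : ε ^ 2 < δ ^ 2) {x : ℝ × ℝ}
    {f g : ℝ → ℝ × ℝ} (hf : Continuous f) (hf0 : f 0 = x)
    (h1 : ∀ τ ∈ Set.Ioc (0 : ℝ) (1 / 2), x.1 = (1 - τ) * (f τ).1 + τ * (g τ).1)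
    (h2 : ∀ τ ∈ Set.Ioc (0 : ℝ) (1 / 2), x.2 = (1 - τ) * (f τ).2 + τ * (g τ).2)
    (hfε : ∀ τ ∈ Set.Icc (0 : ℝ) (1 / 2), (f τ).2 ≤ (f τ).1 ^ 2 + ε ^ 2)
    (hg : ∀ τ ∈ Set.Ioc (0 : ℝ) (1 / 2), (g τ).1 ^ 2 ≤ (g τ).2)
    (hn : ¬ SegmentBelow δ x (f (1 / 2))) :
    ∃ τ ∈ Set.Ioc (0 : ℝ) (1 / 2), √(δ ^ 2 - ε ^ 2) / δ ≤ τ ∧ SegmentBelow δ (f τ) (g τ) := by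
  have hx : x.2 ≤ x.1 ^ 2 + ε ^ 2 := by
    have := hfε 0 ⟨le_rfl, by norm_num⟩
    rwa [hf0] at this
  have hjoint : Continuous (fun p : ℝ × ℝ => parabolaExcess x (f p.1) p.2) := by
    unfold parabolaExcess; fun_prop
  have hθ : ∀ τ, Continuous (parabolaExcess x (f τ)) := fun τ => by
    unfold parabolaExcess; fun_prop
  set M : ℝ → ℝ := fun τ => sSup (parabolaExcess x (f τ) '' Set.Icc 0 1) with hM
  have hMc : Continuous M := isCompact_Icc.continuous_sSup hjoint
  have hbdd : ∀ τ, BddAbove (parabolaExcess x (f τ) '' Set.Icc 0 1) := fun τ =>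
    isCompact_Icc.bddAbove_image (hθ τ).continuousOn
  have hM0 : M 0 ≤ δ ^ 2 := by
    refine csSup_le ((Set.nonempty_Icc.2 zero_le_one).image _) ?_
    rintro _ ⟨θ, -, rfl⟩
    rw [hf0]
    simp only [parabolaExcess]
    nlinarith
  have hM1 : δ ^ 2 ≤ M (1 / 2) := by
    simp only [SegmentBelow, not_forall, not_le] at hn
    obtain ⟨θ, hθ', hn⟩ := hn
    exact hn.le.trans (le_csSup (hbdd _) ⟨θ, hθ', rfl⟩)
  obtain ⟨τ, hτ, hτM⟩ := intermediate_value_Icc (by norm_num : (0 : ℝ) ≤ 1 / 2)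
    hMc.continuousOn ⟨hM0, hM1⟩
  have hmem := (isCompact_Icc.image (hθ τ)).sSup_mem ((Set.nonempty_Icc.2 zero_le_one).image _)
  have hτM' : sSup (parabolaExcess x (f τ) '' Set.Icc 0 1) = δ ^ 2 := hτM
  rw [hτM'] at hmem
  have hτ0 : 0 < τ := by
    refine lt_of_le_of_ne hτ.1 fun h => ?_
    subst h
    obtain ⟨θ, -, h⟩ := hmem
    rw [hf0] at h
    simp only [parabolaExcess] at h
    nlinarith
  have hτ' : τ ∈ Set.Ioc (0 : ℝ) (1 / 2) := ⟨hτ0, hτ.2⟩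
  refine ⟨τ, hτ', segmentBelow_of_tangent hδ hεδ hτ' (h1 τ hτ') (h2 τ hτ') hx (hfε τ hτ) (hg τ hτ')
    (fun θ hθ' => ?_) hmem⟩
  rw [← hτM']
  exact le_csSup (hbdd _) ⟨θ, hθ', rfl⟩

/-- The point of the parabolic strip attached to a function and an interval. -/
noncomputable def bellmanPoint (φ : ℝ → ℝ) (c d : ℝ) : ℝ × ℝ :=
  (iavg φ c d, iavg (fun t => φ t ^ 2) c d)

theorem iavg_split {f : ℝ → ℝ} (hf : LocallyIntegrable f) {c m d τ : ℝ} (hcm : c < m) (hmd : m < d)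
    (hm : m = c + τ * (d - c)) : iavg f c d = (1 - τ) * iavg f m d + τ * iavg f c m := by
  have hI : ∀ p q, IntervalIntegrable f volume p q := fun p q =>
    (hf.integrableOn_isCompact isCompact_uIcc).intervalIntegrable
  have h := intervalIntegral.integral_add_adjacent_intervals (hI c m) (hI m d)
  have e1 : d - c ≠ 0 := by linarith [hcm.trans hmd]
  have e2 : m - c = τ * (d - c) := by linarith
  have e3 : d - m = (1 - τ) * (d - c) := by linarith
  have e4 : τ ≠ 0 := by rintro rfl; simp at hm; linarith
  have e5 : 1 - τ ≠ 0 := by intro h0; rw [h0] at e3; linarith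
  rw [iavg, iavg, iavg, ← h, e2, e3]
  field_simp
  ring

theorem continuous_iavg {f : ℝ → ℝ} (hf : LocallyIntegrable f) {u v : ℝ → ℝ} (hu : Continuous u)
    (hv : Continuous v) (huv : ∀ τ, u τ < v τ) : Continuous fun τ => iavg f (u τ) (v τ) := by
  have hI : ∀ p q, IntervalIntegrable f volume p q := fun p q =>
    (hf.integrableOn_isCompact isCompact_uIcc).intervalIntegrable
  have hc := intervalIntegral.continuous_primitive hI 0
  have e : (fun τ => iavg f (u τ) (v τ)) = fun τ => (v τ - u τ)⁻¹ *
      ((∫ t in (0 : ℝ)..v τ, f t) - ∫ t in (0 : ℝ)..u τ, f t) := by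
    funext τ
    rw [iavg, intervalIntegral.integral_interval_sub_left (hI _ _) (hI _ _)]
  rw [e]
  exact ((hv.sub hu).inv₀ fun τ => (sub_pos.2 (huv τ)).ne').mul
    ((hc.comp hv).sub (hc.comp hu))

/-- Every interval can be cut into two pieces of comparable lengths such that the segment joining
the two corresponding points stays in a slightly larger parabolic strip. -/
theorem exists_split {ε δ : ℝ} (hδ : 0 < δ) (hεδ : ε ^ 2 < δ ^ 2) {a b : ℝ} {φ : ℝ → ℝ}
    (hφ : VarianceBounded ε a b φ) (hl : LocallyIntegrable φ)
    (hl2 : LocallyIntegrable fun t => φ t ^ 2) :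
    ∃ κ : ℝ, 0 < κ ∧ κ < 1 ∧ ∀ c d, a ≤ c → c < d → d ≤ b →
      ∃ m, c < m ∧ m < d ∧ m - c ≤ (1 - κ) * (d - c) ∧ d - m ≤ (1 - κ) * (d - c) ∧
        SegmentBelow δ (bellmanPoint φ c m) (bellmanPoint φ m d) := by
  -- The first term serves the midpoint cut, the second is the lower bound on `τ` from tangency.
  set κ := min (1 / 2) (√(δ ^ 2 - ε ^ 2) / δ) with hκ
  have hκ0 : 0 < κ := lt_min (by norm_num) (div_pos (Real.sqrt_pos.2 (by linarith)) hδ)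
  have hκ1 : κ ≤ 1 / 2 := min_le_left _ _
  refine ⟨κ, hκ0, by linarith, fun c d hac hcd hdb => ?_⟩
  -- Clamping `τ` keeps the longer piece nondegenerate, so that its point is continuous on all of
  -- `ℝ`.
  set p : ℝ → ℝ := fun τ => max 0 (min τ (1 / 2)) with hp
  have hpc : Continuous p := by fun_prop
  have hp0 : ∀ τ, 0 ≤ p τ := fun τ => le_max_left _ _
  have hp1 : ∀ τ, p τ ≤ 1 / 2 := fun τ => max_le (by norm_num) (min_le_right _ _)
  have hpe : ∀ τ ∈ Set.Icc (0 : ℝ) (1 / 2), p τ = τ := fun τ hτ => by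
    simp only [hp]; rw [min_eq_left hτ.2, max_eq_right hτ.1]
  have hlen : 0 < d - c := sub_pos.2 hcd
  have hup : ∀ u v, c ≤ u → u < v → v ≤ d →
      (bellmanPoint φ u v).2 ≤ (bellmanPoint φ u v).1 ^ 2 + ε ^ 2 := fun u v h1 h2 h3 =>
    hφ.variance_le u v (hac.trans h1) h2 (h3.trans hdb)
  have hlow : ∀ u v, c ≤ u → u < v → v ≤ d →
      (bellmanPoint φ u v).1 ^ 2 ≤ (bellmanPoint φ u v).2 := fun u v h1 h2 h3 =>
    sq_iavg_le h2 (hφ.intervalIntegrable (hac.trans h1) h2.le (h3.trans hdb))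
      (hφ.intervalIntegrable_sq (hac.trans h1) h2.le (h3.trans hdb))
  have hfin : ∀ τ ∈ Set.Ioc (0 : ℝ) (1 / 2), κ ≤ τ → κ * (d - c) ≤ τ * (d - c) ∧
      τ * (d - c) ≤ (1 / 2) * (d - c) ∧ 0 < τ * (d - c) := fun τ hτ h =>
    ⟨mul_le_mul_of_nonneg_right h hlen.le, mul_le_mul_of_nonneg_right hτ.2 hlen.le,
      mul_pos hτ.1 hlen⟩
  have hκh := mul_le_mul_of_nonneg_right hκ1 hlen.le
  -- If the segments to both half-intervals are good, cut at the midpoint. Otherwise move the cut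
  -- inwards from an end until the segment to the longer piece, `f τ`, becomes tangent; `g τ` is the
  -- shorter piece.
  by_cases hR : SegmentBelow δ (bellmanPoint φ c d) (bellmanPoint φ (c + 1 / 2 * (d - c)) d)
  · by_cases hL : SegmentBelow δ (bellmanPoint φ c d) (bellmanPoint φ c (d - 1 / 2 * (d - c)))
    · have e : d - 1 / 2 * (d - c) = c + 1 / 2 * (d - c) := by ring
      rw [e] at hL
      refine ⟨c + 1 / 2 * (d - c), by linarith, by linarith, by linarith, by linarith, ?_⟩
      exact (hR.trans (τ := 1 / 2) (by norm_num)
        (iavg_split hl (by linarith) (by linarith) rfl)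
        (iavg_split hl2 (by linarith) (by linarith) rfl) hL).symm
    · obtain ⟨τ, hτ, hκτ, hs⟩ := exists_tangent hδ hεδ (x := bellmanPoint φ c d)
        (f := fun τ => bellmanPoint φ c (d - p τ * (d - c)))
        (g := fun τ => bellmanPoint φ (d - p τ * (d - c)) d)
        ((continuous_iavg hl (by fun_prop) (by fun_prop) fun τ => by nlinarith [hp1 τ]).prodMk
          (continuous_iavg hl2 (by fun_prop) (by fun_prop) fun τ => by nlinarith [hp1 τ]))
        (by simp [hpe 0 (by norm_num)])
        (fun τ hτ => by
          rw [hpe τ ⟨hτ.1.le, hτ.2⟩]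
          have := iavg_split hl (c := c) (d := d) (m := d - τ * (d - c)) (τ := 1 - τ)
            (by nlinarith [hτ.2]) (by nlinarith [hτ.1]) (by ring)
          simp only [bellmanPoint]; linarith)
        (fun τ hτ => by
          rw [hpe τ ⟨hτ.1.le, hτ.2⟩]
          have := iavg_split hl2 (c := c) (d := d) (m := d - τ * (d - c)) (τ := 1 - τ)
            (by nlinarith [hτ.2]) (by nlinarith [hτ.1]) (by ring)
          simp only [bellmanPoint]; linarith)
        (fun τ hτ => hup _ _ le_rfl (by nlinarith [hp1 τ]) (by nlinarith [hp0 τ]))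
        (fun τ hτ => hlow _ _ (by nlinarith [hp1 τ])
          (by rw [hpe τ ⟨hτ.1.le, hτ.2⟩]; nlinarith [hτ.1]) le_rfl)
        (by rwa [hpe (1 / 2) (by norm_num)])
      obtain ⟨h1, h2, h3⟩ := hfin τ hτ ((min_le_right _ _).trans hκτ)
      simp only [hpe τ ⟨hτ.1.le, hτ.2⟩] at hs
      exact ⟨d - τ * (d - c), by linarith, by linarith, by linarith, by linarith, hs⟩
  · obtain ⟨τ, hτ, hκτ, hs⟩ := exists_tangent hδ hεδ (x := bellmanPoint φ c d)
      (f := fun τ => bellmanPoint φ (c + p τ * (d - c)) d)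
      (g := fun τ => bellmanPoint φ c (c + p τ * (d - c)))
      ((continuous_iavg hl (by fun_prop) (by fun_prop) fun τ => by nlinarith [hp1 τ]).prodMk
        (continuous_iavg hl2 (by fun_prop) (by fun_prop) fun τ => by nlinarith [hp1 τ]))
      (by simp [hpe 0 (by norm_num)])
      (fun τ hτ => by
        rw [hpe τ ⟨hτ.1.le, hτ.2⟩]
        exact iavg_split hl (by nlinarith [hτ.1]) (by nlinarith [hτ.2]) rfl)
      (fun τ hτ => by
        rw [hpe τ ⟨hτ.1.le, hτ.2⟩]
        exact iavg_split hl2 (by nlinarith [hτ.1]) (by nlinarith [hτ.2]) rfl)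
      (fun τ hτ => hup _ _ (by nlinarith [hp0 τ]) (by nlinarith [hp1 τ]) le_rfl)
      (fun τ hτ => hlow _ _ le_rfl (by rw [hpe τ ⟨hτ.1.le, hτ.2⟩]; nlinarith [hτ.1])
        (by nlinarith [hp1 τ]))
      (by rwa [hpe (1 / 2) (by norm_num)])
    obtain ⟨h1, h2, h3⟩ := hfin τ hτ ((min_le_right _ _).trans hκτ)
    simp only [hpe τ ⟨hτ.1.le, hτ.2⟩] at hs
    exact ⟨c + τ * (d - c), by linarith, by linarith, by linarith, by linarith, hs.symm⟩

/-! ### Local concavity of the explicit functions. -/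

theorem continuous_explicitUpper (δ : ℝ) : Continuous (explicitUpper δ) := by
  unfold explicitUpper; fun_prop

theorem continuous_explicitLower (δ : ℝ) : Continuous (explicitLower δ) := by
  unfold explicitLower; fun_prop

/-- Along a line, `t ↦ (1 - σ s) exp (x₁ + σ s)` with `s = √(δ² + x₁² - x₂)` has second derivative
`-σ s (q + σ s')² exp (x₁ + σ s)`, where `q` is the slope of `x₁` and `σ = ± 1`. -/
theorem concaveOn_mul_exp_along {p q P Q e σ : ℝ} (hσ : σ = 1 ∨ σ = -1)
    (hD : ∀ t ∈ Set.Icc (0 : ℝ) 1, 0 < e + (p + t * q) ^ 2 - (P + t * Q)) :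
    ConcaveOn ℝ (Set.Icc 0 1) fun t =>
      σ * ((1 - σ * √(e + (p + t * q) ^ 2 - (P + t * Q))) *
        Real.exp (p + t * q + σ * √(e + (p + t * q) ^ 2 - (P + t * Q)))) := by
  set D : ℝ → ℝ := fun t => e + (p + t * q) ^ 2 - (P + t * Q) with hDdef
  have hlin : ∀ t, HasDerivAt (fun t : ℝ => p + t * q) q t := fun t => by
    simpa using ((hasDerivAt_id t).mul_const q).const_add p
  have hD1 : ∀ t, HasDerivAt D (2 * (p + t * q) * q - Q) t := fun t => by
    have h2 : HasDerivAt (fun t : ℝ => P + t * Q) Q t := by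
      simpa using ((hasDerivAt_id t).mul_const Q).const_add P
    refine ((((hlin t).pow 2).const_add e).sub h2).congr_deriv ?_
    simp only [Nat.cast_ofNat, show (2 - 1 : ℕ) = 1 from rfl, pow_one]
  set s : ℝ → ℝ := fun t => √(D t) with hs
  have hs1 : ∀ t, 0 < D t → HasDerivAt s ((2 * (p + t * q) * q - Q) / (2 * s t)) t := fun t ht =>
    (hD1 t).sqrt ht.ne'
  have hE : ∀ t, 0 < D t → HasDerivAt (fun t => Real.exp (p + t * q + σ * s t))
      (Real.exp (p + t * q + σ * s t) * (q + σ * ((2 * (p + t * q) * q - Q) / (2 * s t)))) t :=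
    fun t ht => ((hlin t).add ((hs1 t ht).const_mul σ)).exp
  have hcont : Continuous fun t => σ * ((1 - σ * s t) * Real.exp (p + t * q + σ * s t)) := by
    simp only [hs, hDdef]; fun_prop
  have hpos : ∀ t ∈ interior (Set.Icc (0 : ℝ) 1), 0 < D t := fun t ht => hD t (interior_subset ht)
  -- The identity `s s' = D' / 2` removes the root from the denominator of the first derivative.
  refine concaveOn_of_hasDerivWithinAt2_nonpos (convex_Icc 0 1) hcont.continuousOn
    (f' := fun t => σ * (Real.exp (p + t * q + σ * s t) *
      ((1 - σ * s t) * q - (2 * (p + t * q) * q - Q) / 2)))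
    (f'' := fun t => -(s t * Real.exp (p + t * q + σ * s t) *
      (q + σ * ((2 * (p + t * q) * q - Q) / (2 * s t))) ^ 2)) ?_ ?_ ?_
  · intro t ht
    have hst : s t ≠ 0 := (Real.sqrt_pos.2 (hpos t ht)).ne'
    refine HasDerivAt.hasDerivWithinAt ?_
    refine (((((hs1 t (hpos t ht)).const_mul σ).const_sub 1).mul
      (hE t (hpos t ht))).const_mul σ).congr_deriv ?_
    field_simp
    rcases hσ with rfl | rfl <;> ring
  · intro t ht
    have hst : s t ≠ 0 := (Real.sqrt_pos.2 (hpos t ht)).ne'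
    refine HasDerivAt.hasDerivWithinAt ?_
    have h3 : HasDerivAt (fun t => (1 - σ * s t) * q - (2 * (p + t * q) * q - Q) / 2)
        (-(σ * ((2 * (p + t * q) * q - Q) / (2 * s t))) * q - (2 * q * q) / 2) t :=
      ((((hs1 t (hpos t ht)).const_mul σ).const_sub 1).mul_const q).sub
        (((((hlin t).const_mul 2).mul_const q).sub_const Q).div_const 2)
    refine (((hE t (hpos t ht)).mul h3).const_mul σ).congr_deriv ?_
    field_simp
    rcases hσ with rfl | rfl <;> ring
  · intro t ht
    have : 0 ≤ s t := Real.sqrt_nonneg _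
    exact neg_nonpos.2 (by positivity)

/-- Concavity along the segments that stay below the upper boundary of `bellmanDomain δ`. -/
def LocallyConcaveBelow (δ : ℝ) (B : ℝ × ℝ → ℝ) : Prop :=
  ∀ y z, SegmentBelow δ y z → ∀ θ ∈ Set.Icc (0 : ℝ) 1,
    (1 - θ) * B y + θ * B z ≤ B ((1 - θ) * y.1 + θ * z.1, (1 - θ) * y.2 + θ * z.2)

/-- The strict gap between `δ` and `δ'` keeps the radicand positive along the segment, so the root
is differentiable there. -/
theorem locallyConcaveBelow_mul_exp {δ δ' σ : ℝ} (hσ : σ = 1 ∨ σ = -1) (h : δ ^ 2 < δ' ^ 2) :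
    LocallyConcaveBelow δ fun x => σ * ((1 - σ * √(δ' ^ 2 + x.1 ^ 2 - x.2)) *
        Real.exp (x.1 + σ * √(δ' ^ 2 + x.1 ^ 2 - x.2))) := by
  intro y z hs θ hθ
  have key := (concaveOn_mul_exp_along (p := y.1) (q := z.1 - y.1) (P := y.2) (Q := z.2 - y.2)
    (e := δ' ^ 2) hσ fun t ht => by
      have := hs t ht
      simp only [parabolaExcess] at this
      nlinarith).2
  have key := @key 0 (by simp) 1 (by simp) (1 - θ) θ (by linarith [hθ.2]) hθ.1 (by ring)
  have e1 : y.1 + θ * (z.1 - y.1) = (1 - θ) * y.1 + θ * z.1 := by ring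
  have e2 : y.2 + θ * (z.2 - y.2) = (1 - θ) * y.2 + θ * z.2 := by ring
  simpa [e1, e2] using key

theorem LocallyConcaveBelow.const_mul {δ k : ℝ} {B : ℝ × ℝ → ℝ} (hB : LocallyConcaveBelow δ B)
    (hk : 0 ≤ k) : LocallyConcaveBelow δ fun x => k * B x := fun y z hs θ hθ => by
  have := mul_le_mul_of_nonneg_left (hB y z hs θ hθ) hk
  linarith

theorem locallyConcaveBelow_explicitUpper {δ δ' : ℝ} (h : δ ^ 2 < δ' ^ 2) (h1 : δ' < 1) :
    LocallyConcaveBelow δ (explicitUpper δ') := by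
  have := (locallyConcaveBelow_mul_exp (Or.inl rfl) h).const_mul
    (k := (1 - δ')⁻¹ * Real.exp (-δ')) (mul_nonneg (inv_nonneg.2 (by linarith)) (Real.exp_nonneg _))
  convert this using 2 with x
  rw [explicitUpper, one_mul, one_mul, Real.exp_sub, Real.exp_neg]
  ring

theorem locallyConcaveBelow_neg_explicitLower {δ δ' : ℝ} (h : δ ^ 2 < δ' ^ 2) (h0 : 0 ≤ δ') :
    LocallyConcaveBelow δ fun x => -explicitLower δ' x := by
  have := (locallyConcaveBelow_mul_exp (Or.inr rfl) h).const_mul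
    (k := (1 + δ')⁻¹ * Real.exp δ') (mul_nonneg (inv_nonneg.2 (by linarith)) (Real.exp_nonneg _))
  convert this using 2 with x
  rw [explicitLower, Real.exp_add _ δ']
  ring_nf

theorem explicitUpper_parabola {δ : ℝ} (h0 : 0 ≤ δ) (h1 : δ < 1) (u : ℝ) :
    explicitUpper δ (u, u ^ 2) = Real.exp u := by
  have : 1 - δ ≠ 0 := by linarith
  simp [explicitUpper, Real.sqrt_sq h0, this]

theorem explicitLower_parabola {δ : ℝ} (h0 : 0 ≤ δ) (u : ℝ) :
    explicitLower δ (u, u ^ 2) = Real.exp u := by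
  have : 1 + δ ≠ 0 := by linarith
  simp [explicitLower, Real.sqrt_sq h0, this]

/-! ### Bellman induction. -/

/-- Starting from `[c, d]` and cutting repeatedly according to `m`, the interval of the `n`-th
generation that contains `s`. -/
noncomputable def leaf (m : ℝ → ℝ → ℝ) : ℕ → ℝ → ℝ → ℝ → ℝ × ℝ
  | 0, c, d, _ => (c, d)
  | n + 1, c, d, s => if s ≤ m c d then leaf m n c (m c d) s else leaf m n (m c d) d s

/-- A rule that cuts every subinterval of `[a, b]` into pieces of comparable lengths. -/
def IsSplitting (κ a b : ℝ) (m : ℝ → ℝ → ℝ) : Prop :=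
  ∀ c d, a ≤ c → c < d → d ≤ b → c < m c d ∧ m c d < d ∧
    m c d - c ≤ (1 - κ) * (d - c) ∧ d - m c d ≤ (1 - κ) * (d - c)

theorem leaf_spec {κ a b : ℝ} (hκ : κ < 1) {m : ℝ → ℝ → ℝ} (hm : IsSplitting κ a b m) (n : ℕ) :
    ∀ c d s, a ≤ c → c < d → d ≤ b → s ∈ Set.Ioc c d →
      a ≤ (leaf m n c d s).1 ∧ (leaf m n c d s).1 < s ∧ s ≤ (leaf m n c d s).2 ∧
      (leaf m n c d s).2 ≤ b ∧
      (leaf m n c d s).2 - (leaf m n c d s).1 ≤ (1 - κ) ^ n * (d - c) := by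
  induction n with
  | zero => intro c d s hac hcd hdb hs; simp [leaf, hac, hdb, hs.1, hs.2]
  | succ n ih =>
    intro c d s hac hcd hdb hs
    obtain ⟨h1, h2, h3, h4⟩ := hm c d hac hcd hdb
    have hp : 0 ≤ (1 - κ) ^ n := pow_nonneg (by linarith) n
    by_cases h : s ≤ m c d
    · simp only [leaf, if_pos h]
      obtain ⟨g1, g2, g3, g4, g5⟩ := ih c (m c d) s hac h1 (h2.le.trans hdb) ⟨hs.1, h⟩
      refine ⟨g1, g2, g3, g4, g5.trans ?_⟩
      rw [pow_succ, mul_assoc]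
      exact mul_le_mul_of_nonneg_left h3 hp
    · simp only [leaf, if_neg h]
      obtain ⟨g1, g2, g3, g4, g5⟩ := ih (m c d) d s (hac.trans h1.le) h2 hdb ⟨not_le.1 h, hs.2⟩
      refine ⟨g1, g2, g3, g4, g5.trans ?_⟩
      rw [pow_succ, mul_assoc]
      exact mul_le_mul_of_nonneg_left h4 hp

/-- The integral encodes the sum of `|J| G(J)` over the `n`-th generation as the integral of a step
function; each cut can only decrease that sum. -/
theorem integral_leaf_le {κ a b : ℝ} {m : ℝ → ℝ → ℝ} (hm : IsSplitting κ a b m) {G : ℝ → ℝ → ℝ}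
    (hG : ∀ c d, a ≤ c → c < d → d ≤ b →
      (m c d - c) * G c (m c d) + (d - m c d) * G (m c d) d ≤ (d - c) * G c d) (n : ℕ) :
    ∀ c d, a ≤ c → c < d → d ≤ b →
      IntervalIntegrable (fun s => G (leaf m n c d s).1 (leaf m n c d s).2) volume c d ∧
      ∫ s in c..d, G (leaf m n c d s).1 (leaf m n c d s).2 ≤ (d - c) * G c d := by
  induction n with
  | zero => intro c d hac hcd hdb; simp [leaf]
  | succ n ih =>
    intro c d hac hcd hdb
    obtain ⟨h1, h2, -, -⟩ := hm c d hac hcd hdb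
    obtain ⟨i1, i2⟩ := ih c (m c d) hac h1 (h2.le.trans hdb)
    obtain ⟨j1, j2⟩ := ih (m c d) d (hac.trans h1.le) h2 hdb
    have e1 : Set.EqOn (fun s => G (leaf m n c (m c d) s).1 (leaf m n c (m c d) s).2)
        (fun s => G (leaf m (n + 1) c d s).1 (leaf m (n + 1) c d s).2) (Set.uIoc c (m c d)) := by
      intro s hs
      rw [Set.uIoc_of_le h1.le] at hs
      simp only [leaf, if_pos hs.2]
    have e2 : Set.EqOn (fun s => G (leaf m n (m c d) d s).1 (leaf m n (m c d) d s).2)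
        (fun s => G (leaf m (n + 1) c d s).1 (leaf m (n + 1) c d s).2) (Set.uIoc (m c d) d) := by
      intro s hs
      rw [Set.uIoc_of_le h2.le] at hs
      simp only [leaf, if_neg (not_le.2 hs.1)]
    have i3 := i1.congr e1
    have j3 := j1.congr e2
    refine ⟨i3.trans j3, ?_⟩
    rw [← intervalIntegral.integral_add_adjacent_intervals i3 j3,
      ← intervalIntegral.integral_congr_ae (Eventually.of_forall e1),
      ← intervalIntegral.integral_congr_ae (Eventually.of_forall e2)]
    exact (add_le_add i2 j2).trans (hG c d hac hcd hdb)

/-- Lebesgue differentiation along intervals that contain `s` without being centred there; the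
exceptional null set does not depend on the sequences. -/
theorem ae_tendsto_iavg {f : ℝ → ℝ} (hf : LocallyIntegrable f) :
    ∀ᵐ s, ∀ P Q : ℕ → ℝ, (∀ n, P n < s ∧ s ≤ Q n) → Tendsto (fun n => Q n - P n) atTop (𝓝 0) →
      Tendsto (fun n => iavg f (P n) (Q n)) atTop (𝓝 (f s)) := by
  filter_upwards [IsUnifLocDoublingMeasure.ae_tendsto_average volume hf 1] with s hs P Q h h0
  have hlim : Tendsto (fun n => (Q n - P n) / 2) atTop (𝓝[>] 0) := by
    refine tendsto_nhdsWithin_iff.2 ⟨by simpa using h0.div_const 2, ?_⟩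
    refine Eventually.of_forall fun n => ?_
    have := h n
    simp only [Set.mem_Ioi]; linarith
  have hball : ∀ n, Metric.closedBall ((P n + Q n) / 2) ((Q n - P n) / 2) = Set.Icc (P n) (Q n) :=
    fun n => by rw [Real.closedBall_eq_Icc]; congr 1 <;> ring
  have := hs (fun n => (P n + Q n) / 2) (fun n => (Q n - P n) / 2) hlim
    (Eventually.of_forall fun n => by rw [one_mul, hball]; exact ⟨(h n).1.le, (h n).2⟩)
  refine this.congr fun n => ?_
  rw [hball, setAverage_Icc_eq_iavg _ ((h n).1.trans_le (h n).2)]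

theorem bellman_split {δ : ℝ} {B : ℝ × ℝ → ℝ} (hc : LocallyConcaveBelow δ B) {φ : ℝ → ℝ}
    (hl : LocallyIntegrable φ) (hl2 : LocallyIntegrable fun t => φ t ^ 2) {c m d : ℝ}
    (h1 : c < m) (h2 : m < d) (hs : SegmentBelow δ (bellmanPoint φ c m) (bellmanPoint φ m d)) :
    (m - c) * B (bellmanPoint φ c m) + (d - m) * B (bellmanPoint φ m d) ≤
      (d - c) * B (bellmanPoint φ c d) := by
  have hlen : 0 < d - c := by linarith
  have hm : m = c + (m - c) / (d - c) * (d - c) := by field_simp; ring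
  have e : bellmanPoint φ c d = ((1 - (d - m) / (d - c)) * (bellmanPoint φ c m).1 +
      (d - m) / (d - c) * (bellmanPoint φ m d).1, (1 - (d - m) / (d - c)) * (bellmanPoint φ c m).2 +
      (d - m) / (d - c) * (bellmanPoint φ m d).2) := by
    simp only [bellmanPoint]
    rw [iavg_split hl h1 h2 hm, iavg_split hl2 h1 h2 hm]
    ext <;> · simp only; field_simp; ring
  have key := hc _ _ hs ((d - m) / (d - c)) ⟨div_nonneg (by linarith) hlen.le, by
    rw [div_le_one hlen]; linarith⟩
  rw [← e] at key
  have := mul_le_mul_of_nonneg_left key hlen.le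
  refine le_trans (le_of_eq ?_) this
  field_simp
  ring

/-- Confines all points to one compact rectangle, where a continuous `B` is bounded; this supplies
the dominating constant in the limit. -/
theorem bellmanPoint_mem {φ : ℝ → ℝ} (hl : LocallyIntegrable φ)
    (hl2 : LocallyIntegrable fun t => φ t ^ 2) {N : ℝ} (hN : ∀ t, |φ t| ≤ N) {c d : ℝ}
    (h : c < d) : bellmanPoint φ c d ∈ Set.Icc (-N) N ×ˢ Set.Icc 0 (N ^ 2) := by
  have h1 : IntervalIntegrable φ volume c d :=
    (hl.integrableOn_isCompact isCompact_uIcc).intervalIntegrable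
  have h2 : IntervalIntegrable (fun t => φ t ^ 2) volume c d :=
    (hl2.integrableOn_isCompact isCompact_uIcc).intervalIntegrable
  have hk : ∀ k : ℝ, IntervalIntegrable (fun _ => k) volume c d := fun k => by simp
  refine ⟨⟨?_, ?_⟩, ?_, ?_⟩
  · exact (iavg_const (-N) h).symm.le.trans
      (iavg_mono h.le (hk _) h1 fun t => (abs_le.1 (hN t)).1)
  · exact (iavg_mono h.le h1 (hk _) fun t => (abs_le.1 (hN t)).2).trans (iavg_const N h).le
  · exact (iavg_const 0 h).symm.le.trans (iavg_mono h.le (hk _) h2 fun t => sq_nonneg _)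
  · refine (iavg_mono h.le h2 (hk _) fun t => ?_).trans (iavg_const (N ^ 2) h).le
    rw [← sq_abs]
    exact pow_le_pow_left₀ (abs_nonneg _) (hN t) 2

theorem bellman_induction_of_locallyIntegrable {ε δ : ℝ} (hδ : 0 < δ) (hεδ : ε ^ 2 < δ ^ 2)
    {B : ℝ × ℝ → ℝ} (hB : Continuous B) (hc : LocallyConcaveBelow δ B) {a b : ℝ} (hab : a < b)
    {φ : ℝ → ℝ} (hφ : VarianceBounded ε a b φ) (hl : LocallyIntegrable φ)
    (hl2 : LocallyIntegrable fun t => φ t ^ 2) {N : ℝ} (hN : ∀ t, |φ t| ≤ N) :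
    iavg (fun t => B (φ t, φ t ^ 2)) a b ≤ B (bellmanPoint φ a b) := by
  obtain ⟨κ, hκ0, hκ1, hsplit⟩ := exists_split hδ hεδ hφ hl hl2
  choose! m hm using hsplit
  have hm' : IsSplitting κ a b m := fun c d h1 h2 h3 =>
    ⟨(hm c d h1 h2 h3).1, (hm c d h1 h2 h3).2.1, (hm c d h1 h2 h3).2.2.1, (hm c d h1 h2 h3).2.2.2.1⟩
  have hint := fun n => integral_leaf_le hm' (G := fun c d => B (bellmanPoint φ c d))
    (fun c d h1 h2 h3 => bellman_split hc hl hl2 (hm c d h1 h2 h3).1 (hm c d h1 h2 h3).2.1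
      (hm c d h1 h2 h3).2.2.2.2) n a b le_rfl hab le_rfl
  have hspec := fun n s hs => leaf_spec hκ1 hm' n a b s le_rfl hab le_rfl hs
  obtain ⟨C, hC⟩ := (isCompact_Icc.prod isCompact_Icc).exists_bound_of_continuousOn
    (s := Set.Icc (-N) N ×ˢ Set.Icc 0 (N ^ 2)) hB.continuousOn
  have hlim : Tendsto (fun n => ∫ s in a..b, B (bellmanPoint φ (leaf m n a b s).1 (leaf m n a b s).2))
      atTop (𝓝 (∫ s in a..b, B (φ s, φ s ^ 2))) := by
    refine intervalIntegral.tendsto_integral_filter_of_dominated_convergence (fun _ => C)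
      (Eventually.of_forall fun n => by rw [Set.uIoc_of_le hab.le]; exact (hint n).1.1.1)
      (Eventually.of_forall fun n => Eventually.of_forall fun s hs => ?_) (by simp) ?_
    · rw [Set.uIoc_of_le hab.le] at hs
      obtain ⟨-, g1, g2, -, -⟩ := hspec n s hs
      exact hC _ (bellmanPoint_mem hl hl2 hN (g1.trans_le g2))
    · filter_upwards [ae_tendsto_iavg hl, ae_tendsto_iavg hl2] with s h1 h2 hs
      rw [Set.uIoc_of_le hab.le] at hs
      have hP : ∀ n, (leaf m n a b s).1 < s ∧ s ≤ (leaf m n a b s).2 := fun n =>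
        ⟨(hspec n s hs).2.1, (hspec n s hs).2.2.1⟩
      have h0 : Tendsto (fun n => (leaf m n a b s).2 - (leaf m n a b s).1) atTop (𝓝 0) := by
        refine squeeze_zero (fun n => by linarith [(hP n).1, (hP n).2])
          (fun n => (hspec n s hs).2.2.2.2) ?_
        simpa using (tendsto_pow_atTop_nhds_zero_of_lt_one (by linarith : 0 ≤ 1 - κ)
          (by linarith)).mul_const (b - a)
      exact (hB.tendsto _).comp ((h1 _ _ hP h0).prodMk_nhds (h2 _ _ hP h0))
  have hfin := le_of_tendsto' hlim fun n => (hint n).2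
  have := mul_le_mul_of_nonneg_left hfin (inv_nonneg.2 (sub_pos.2 hab).le)
  rwa [inv_mul_cancel_left₀ (sub_pos.2 hab).ne'] at this

/-- Bellman induction: a continuous function that is locally concave in a slightly larger parabolic
strip majorises the averages of its boundary values. -/
theorem bellman_induction {ε δ : ℝ} (hδ : 0 < δ) (hεδ : ε ^ 2 < δ ^ 2)
    {B : ℝ × ℝ → ℝ} (hB : Continuous B) (hc : LocallyConcaveBelow δ B) {a b : ℝ} (hab : a < b)
    {φ : ℝ → ℝ} (hφ : VarianceBounded ε a b φ) {N : ℝ} (hN : ∀ t, |φ t| ≤ N) :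
    iavg (fun t => B (φ t, φ t ^ 2)) a b ≤ B (bellmanPoint φ a b) := by
  -- Cutting and differentiation use local integrability on the whole line; extension by zero
  -- provides it without changing averages inside `[a, b]`.
  set ψ := (Set.Icc a b).indicator φ with hψ
  have hin : ∀ t ∈ Set.Icc a b, ψ t = φ t := fun t ht => Set.indicator_of_mem ht _
  have hav : ∀ (F : ℝ → ℝ) c d, a ≤ c → c < d → d ≤ b →
      iavg (fun t => F (ψ t)) c d = iavg (fun t => F (φ t)) c d := fun F c d h1 h2 h3 =>
    iavg_congr h2.le fun t ht => by rw [hin t ⟨h1.trans ht.1.le, ht.2.trans h3⟩]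
  have hsq : (fun t => ψ t ^ 2) = (Set.Icc a b).indicator fun t => φ t ^ 2 := by
    funext t
    by_cases ht : t ∈ Set.Icc a b <;> simp [hψ, ht]
  have hi : Integrable ψ := hφ.integrable.integrable_indicator measurableSet_Icc
  have hi2 : Integrable fun t => ψ t ^ 2 := by
    rw [hsq]; exact hφ.integrable_sq.integrable_indicator measurableSet_Icc
  have hψV : VarianceBounded ε a b ψ := ⟨hi.integrableOn, hi2.integrableOn, fun c d h1 h2 h3 => by
    rw [hav (fun x => x ^ 2) c d h1 h2 h3, hav (fun x => x) c d h1 h2 h3]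
    exact hφ.variance_le c d h1 h2 h3⟩
  have hψN : ∀ t, |ψ t| ≤ N := fun t => by
    by_cases ht : t ∈ Set.Icc a b
    · rw [hin t ht]; exact hN t
    · rw [hψ, Set.indicator_of_notMem ht, abs_zero]; exact (abs_nonneg _).trans (hN t)
  have := bellman_induction_of_locallyIntegrable hδ hεδ hB hc hab hψV hi.locallyIntegrable
    hi2.locallyIntegrable hψN
  rwa [hav (fun x => B (x, x ^ 2)) a b le_rfl hab le_rfl, bellmanPoint,
    hav (fun x => x ^ 2) a b le_rfl hab le_rfl, hav (fun x => x) a b le_rfl hab le_rfl] at this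

/-! ### Logarithms and the extremal functions. -/

theorem continuousOn_mul_log_sq {c d : ℝ} (hc : 0 ≤ c) :
    ContinuousOn (fun t : ℝ => t * Real.log t ^ 2 - 2 * (t * Real.log t) + 2 * t)
      (Set.Icc c d) := by
  -- Continuity of `t log² t` at `0` follows from that of `t log t`, by `t log² t = 4 (√t log √t)²`.
  have h : Continuous fun t : ℝ =>
      4 * (√t * Real.log √t) ^ 2 - 2 * (t * Real.log t) + 2 * t :=
    ((continuous_const.mul ((Real.continuous_mul_log.comp Real.continuous_sqrt).pow 2)).sub
      (continuous_const.mul Real.continuous_mul_log)).add (by fun_prop)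
  refine h.continuousOn.congr fun t ht => ?_
  have h0 : 0 ≤ t := hc.trans ht.1
  simp only [Real.log_sqrt h0, mul_pow, div_pow, Real.sq_sqrt h0]
  ring

theorem hasDerivAt_mul_log_sq {t : ℝ} (ht : t ≠ 0) :
    HasDerivAt (fun t : ℝ => t * Real.log t ^ 2 - 2 * (t * Real.log t) + 2 * t)
      (Real.log t ^ 2) t := by
  have h1 := hasDerivAt_id t
  have h2 := Real.hasDerivAt_log ht
  refine ((((h1.mul (h2.pow 2)).sub ((h1.mul h2).const_mul 2)).add
    (h1.const_mul 2))).congr_deriv ?_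
  simp only [id, Pi.pow_apply, Nat.cast_ofNat, show (2 - 1 : ℕ) = 1 from rfl, pow_one]
  field_simp
  ring

theorem intervalIntegrable_log_sq {c d : ℝ} (hc : 0 ≤ c) (hcd : c ≤ d) :
    IntervalIntegrable (fun t => Real.log t ^ 2) volume c d := by
  rw [intervalIntegrable_iff_integrableOn_Ioc_of_le hcd]
  exact intervalIntegral.integrableOn_deriv_of_nonneg (continuousOn_mul_log_sq hc)
    (fun t ht => hasDerivAt_mul_log_sq (hc.trans_lt ht.1).ne') fun _ _ => sq_nonneg _

theorem integral_log_sq {c d : ℝ} (hc : 0 ≤ c) (hcd : c ≤ d) :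
    ∫ t in c..d, Real.log t ^ 2 = (d * Real.log d ^ 2 - 2 * (d * Real.log d) + 2 * d) -
      (c * Real.log c ^ 2 - 2 * (c * Real.log c) + 2 * c) :=
  intervalIntegral.integral_eq_sub_of_hasDerivAt_of_le hcd (continuousOn_mul_log_sq hc)
    (fun _ ht => hasDerivAt_mul_log_sq (hc.trans_lt ht.1).ne') (intervalIntegrable_log_sq hc hcd)

theorem iavg_comp_sub (f : ℝ → ℝ) (a c d : ℝ) :
    iavg (fun t => f (t - a)) c d = iavg f (c - a) (d - a) := by
  rw [iavg, iavg, intervalIntegral.integral_comp_sub_right]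
  congr 2; ring

/-- The logarithm has variance at most `1` on every interval of positive numbers. -/
theorem varianceBounded_log {L : ℝ} (hL : 0 ≤ L) : VarianceBounded 1 0 L Real.log := by
  refine ⟨?_, ?_, fun c d hc hcd _ => ?_⟩
  · rw [← intervalIntegrable_iff_integrableOn_Icc_of_le hL]
    exact intervalIntegral.intervalIntegrable_log'
  · rw [← intervalIntegrable_iff_integrableOn_Icc_of_le hL]
    exact intervalIntegrable_log_sq le_rfl hL
  · have hlen : 0 < d - c := sub_pos.2 hcd
    rw [iavg, iavg, integral_log_sq hc hcd.le, integral_log, ← sub_nonneg]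
    -- This quantity is exactly `1` minus the variance of `log` on `[c, d]`.
    have : 0 ≤ c * d * (Real.log d - Real.log c) ^ 2 / (d - c) ^ 2 := by
      have : 0 ≤ d := hc.trans hcd.le
      positivity
    convert this using 1
    field_simp
    ring

theorem VarianceBounded.comp_sub {ε a b : ℝ} {φ : ℝ → ℝ} (hab : a ≤ b)
    (h : VarianceBounded ε 0 (b - a) φ) : VarianceBounded ε a b fun t => φ (t - a) := by
  have hi : ∀ {f : ℝ → ℝ}, IntegrableOn f (Set.Icc 0 (b - a)) →
      IntegrableOn (fun t => f (t - a)) (Set.Icc a b) := fun {f} hf => by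
    rw [← intervalIntegrable_iff_integrableOn_Icc_of_le hab]
    rw [← intervalIntegrable_iff_integrableOn_Icc_of_le (sub_nonneg.2 hab)] at hf
    simpa using hf.comp_sub_right a
  refine ⟨hi h.integrable, hi h.integrable_sq, fun c d hac hcd hdb => ?_⟩
  rw [iavg_comp_sub (fun t => φ t ^ 2), iavg_comp_sub]
  exact h.variance_le _ _ (by linarith) (by linarith) (by linarith)

/-- The positive part of a logarithm, with a singularity at `0`, vanishing to the right of `g`. -/
noncomputable def logBump (g t : ℝ) : ℝ := max (Real.log g - Real.log t) 0

theorem varianceBounded_logBump (g : ℝ) {L : ℝ} (hL : 0 ≤ L) :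
    VarianceBounded 1 0 L (logBump g) := by
  refine (varianceBounded_log hL).comp_lipschitz (T := fun y => max (Real.log g - y) 0) ?_
  have : LipschitzWith 1 fun y : ℝ => Real.log g - y := by
    refine LipschitzWith.of_dist_le_mul fun x y => ?_
    rw [NNReal.coe_one, one_mul, Real.dist_eq, Real.dist_eq, ← abs_neg (x - y)]
    exact le_of_eq (by congr 1; ring)
  exact this.max_const 0

theorem integral_comp_logBump {H F : ℝ → ℝ} {g L : ℝ} (hg : 0 < g) (hgL : g ≤ L)
    (hF : ∀ t ∈ Set.Ioc 0 g, H (Real.log g - Real.log t) = F t)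
    (hi : IntervalIntegrable F volume 0 g) :
    IntervalIntegrable (fun t => H (logBump g t)) volume 0 L ∧
      ∫ t in (0 : ℝ)..L, H (logBump g t) = (∫ t in (0 : ℝ)..g, F t) + (L - g) * H 0 := by
  have e1 : Set.EqOn F (fun t => H (logBump g t)) (Set.uIoc 0 g) := fun t ht => by
    rw [Set.uIoc_of_le hg.le] at ht
    simp only [logBump]
    rw [max_eq_left (sub_nonneg.2 (Real.log_le_log ht.1 ht.2)), hF t ht]
  have e2 : Set.EqOn (fun _ => H 0) (fun t => H (logBump g t)) (Set.uIoc g L) := fun t ht => by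
    rw [Set.uIoc_of_le hgL] at ht
    simp only [logBump]
    rw [max_eq_right (sub_nonpos.2 (Real.log_le_log hg ht.1.le))]
  have i1 := hi.congr e1
  have i2 : IntervalIntegrable (fun t => H (logBump g t)) volume g L :=
    IntervalIntegrable.congr e2 (by simp)
  refine ⟨i1.trans i2, ?_⟩
  rw [← intervalIntegral.integral_add_adjacent_intervals i1 i2,
    ← intervalIntegral.integral_congr_ae (Eventually.of_forall e1),
    ← intervalIntegral.integral_congr_ae (Eventually.of_forall e2)]
  simp

theorem integral_logBump {g L : ℝ} (hg : 0 < g) (hgL : g ≤ L) :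
    ∫ t in (0 : ℝ)..L, logBump g t = g := by
  have h := (integral_comp_logBump (H := fun y => y) hg hgL (fun t _ => rfl)
    ((by simp : IntervalIntegrable (fun _ => Real.log g) volume 0 g).sub
      intervalIntegral.intervalIntegrable_log')).2
  rw [h, intervalIntegral.integral_sub (by simp) intervalIntegral.intervalIntegrable_log',
    integral_log]
  simp

theorem integral_logBump_sq {g L : ℝ} (hg : 0 < g) (hgL : g ≤ L) :
    ∫ t in (0 : ℝ)..L, logBump g t ^ 2 = 2 * g := by
  have hl : IntervalIntegrable Real.log volume 0 g := intervalIntegral.intervalIntegrable_log'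
  have hl2 := intervalIntegrable_log_sq le_rfl hg.le
  have hc : IntervalIntegrable (fun _ : ℝ => Real.log g ^ 2) volume 0 g := by simp
  have h := (integral_comp_logBump (H := fun y => y ^ 2)
    (F := fun t => Real.log g ^ 2 - 2 * Real.log g * Real.log t + Real.log t ^ 2) hg hgL
    (fun t _ => by ring) ((hc.sub (hl.const_mul _)).add hl2)).2
  rw [h, intervalIntegral.integral_add (hc.sub (hl.const_mul _)) hl2,
    intervalIntegral.integral_sub hc (hl.const_mul _), intervalIntegral.integral_const_mul,
    integral_log, integral_log_sq le_rfl hg.le, intervalIntegral.integral_const]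
  simp only [smul_eq_mul, Real.log_zero]
  ring

theorem exp_mul_log_sub {σ g t : ℝ} (hg : 0 < g) (ht : 0 < t) :
    Real.exp (σ * (Real.log g - Real.log t)) = g ^ σ * t ^ (-σ) := by
  rw [Real.rpow_def_of_pos hg, Real.rpow_def_of_pos ht, ← Real.exp_add]
  congr 1; ring

/-- On `(0, g]` the integrand is `(g / t)^σ`, and to the right of `g` it is `1`. Negative `σ` is
included for the lower function. -/
theorem integral_exp_logBump {σ g L : ℝ} (hσ : σ < 1) (hg : 0 < g) (hgL : g ≤ L) :
    IntervalIntegrable (fun t => Real.exp (σ * logBump g t)) volume 0 L ∧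
      ∫ t in (0 : ℝ)..L, Real.exp (σ * logBump g t) = g / (1 - σ) + (L - g) := by
  have h := integral_comp_logBump (H := fun y => Real.exp (σ * y)) (F := fun t => g ^ σ * t ^ (-σ))
    hg hgL (fun t ht => exp_mul_log_sub hg ht.1)
    ((intervalIntegral.intervalIntegrable_rpow' (by linarith)).const_mul _)
  refine ⟨h.1, h.2.trans ?_⟩
  have hne : 1 - σ ≠ 0 := by linarith
  have e : -σ + 1 = 1 - σ := by ring
  rw [intervalIntegral.integral_const_mul, integral_rpow (Or.inl (by linarith)), e,
    Real.zero_rpow hne, Real.rpow_sub hg, Real.rpow_one]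
  have : g ^ σ ≠ 0 := (Real.rpow_pos_of_pos hg σ).ne'
  simp
  field_simp

/-- The integrand dominates `g / t` on `(0, g]`; this is the source of the threshold `ε = 1`. -/
theorem not_intervalIntegrable_exp_logBump {σ g L : ℝ} (hσ : 1 ≤ σ) (hg : 0 < g) (hgL : g ≤ L) :
    ¬ IntervalIntegrable (fun t => Real.exp (σ * logBump g t)) volume 0 L := by
  intro h
  have h1 : IntervalIntegrable (fun t => Real.exp (σ * logBump g t)) volume 0 g :=
    h.mono_set (by
      rw [Set.uIcc_of_le hg.le, Set.uIcc_of_le (hg.le.trans hgL)]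
      exact Set.Icc_subset_Icc le_rfl hgL)
  have h2 : IntervalIntegrable (fun t : ℝ => t⁻¹) volume 0 g := by
    refine (h1.const_mul g⁻¹).mono_fun (by fun_prop) ?_
    rw [Set.uIoc_of_le hg.le]
    filter_upwards [ae_restrict_mem measurableSet_Ioc] with t ht
    have hb : 0 ≤ Real.log g - Real.log t := sub_nonneg.2 (Real.log_le_log ht.1 ht.2)
    have hg0 := inv_pos.2 hg
    rw [Real.norm_of_nonneg (inv_nonneg.2 ht.1.le), Real.norm_of_nonneg (by positivity), logBump,
      max_eq_left hb]
    have : g * t⁻¹ ≤ Real.exp (σ * (Real.log g - Real.log t)) := by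
      calc g * t⁻¹ = Real.exp (Real.log g - Real.log t) := by
            rw [Real.exp_sub, Real.exp_log hg, Real.exp_log ht.1, div_eq_mul_inv]
        _ ≤ _ := Real.exp_le_exp.2 (by nlinarith)
    calc t⁻¹ = g⁻¹ * (g * t⁻¹) := by field_simp
      _ ≤ _ := mul_le_mul_of_nonneg_left this hg0.le
  rw [intervalIntegrable_inv_iff] at h2
  rcases h2 with h2 | h2
  · exact hg.ne h2
  · exact h2 Set.left_mem_uIcc

/-- The extremal functions: a constant plus a multiple of the positive part of a logarithm with
singularity at `a`, normalised to have average `u` on `[a, b]`. -/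
noncomputable def extremal (a b u σ γ t : ℝ) : ℝ :=
  u - σ * γ + σ * logBump (γ * (b - a)) (t - a)

/-- The bump has mean `γ` and mean square `2 γ`, hence variance `2 γ - γ² = 1 - (1 - γ)²`. Only `σ²`
enters, so `ε` and `-ε` give the same point. -/
theorem extremal_mem {a b ε σ γ u : ℝ} (hε : 0 ≤ ε) (hab : a < b) (hσ : σ ^ 2 = ε ^ 2)
    (h0 : 0 < γ) (h1 : γ ≤ 1) :
    extremal a b u σ γ ∈
      bellmanAdmissible ε a b (u, u ^ 2 + σ ^ 2 * (1 - (1 - γ) ^ 2)) := by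
  have hL : 0 < b - a := sub_pos.2 hab
  have hg : 0 < γ * (b - a) := mul_pos h0 hL
  have hgL : γ * (b - a) ≤ b - a := by nlinarith
  have hV := (varianceBounded_logBump (γ * (b - a)) hL.le).comp_sub hab.le
  have hV' := hV.const_add_mul (u - σ * γ) σ
  have i1 := hV.intervalIntegrable le_rfl hab.le le_rfl
  have i2 := hV.intervalIntegrable_sq le_rfl hab.le le_rfl
  have m1 : iavg (fun t => logBump (γ * (b - a)) (t - a)) a b = γ := by
    rw [iavg_comp_sub, sub_self, iavg, sub_zero, integral_logBump hg hgL]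
    field_simp
  have m2 : iavg (fun t => logBump (γ * (b - a)) (t - a) ^ 2) a b = 2 * γ := by
    rw [iavg_comp_sub (fun t => logBump (γ * (b - a)) t ^ 2), sub_self, iavg, sub_zero,
      integral_logBump_sq hg hgL]
    field_simp
  rw [mem_bellmanAdmissible_iff hε hab]
  refine ⟨⟨hV'.integrable, hV'.integrable_sq, fun c d h1 h2 h3 => ?_⟩, ?_, ?_⟩
  · have := hV'.variance_le c d h1 h2 h3
    rwa [mul_one, hσ] at this
  · unfold extremal
    rw [iavg_const_add_mul _ _ hab i1, m1]
    ring
  · have e : (fun t => extremal a b u σ γ t ^ 2) = fun t => (u - σ * γ) ^ 2 +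
        (2 * (u - σ * γ) * σ) * logBump (γ * (b - a)) (t - a) +
        σ ^ 2 * logBump (γ * (b - a)) (t - a) ^ 2 := by
      funext t; simp only [extremal]; ring
    rw [e, iavg_quadratic _ _ _ hab i1 i2, m1, m2]
    ring

theorem exp_extremal (a b u σ γ t : ℝ) : Real.exp (extremal a b u σ γ t) =
    Real.exp (u - σ * γ) * Real.exp (σ * logBump (γ * (b - a)) (t - a)) := by
  rw [extremal, Real.exp_add]

theorem expAverage_extremal {a b u σ γ : ℝ} (hab : a < b) (hσ : σ < 1) (h0 : 0 < γ) (h1 : γ ≤ 1) :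
    expAverage a b (extremal a b u σ γ) =
      ENNReal.ofReal (Real.exp (u - σ * γ) * (γ / (1 - σ) + (1 - γ))) := by
  have hL : 0 < b - a := sub_pos.2 hab
  have h := integral_exp_logBump hσ (mul_pos h0 hL) (by nlinarith : γ * (b - a) ≤ b - a)
  have hi : IntervalIntegrable (fun t => Real.exp (σ * logBump (γ * (b - a)) (t - a)))
      volume a b := by simpa using h.1.comp_sub_right a
  have hi' : IntegrableOn (fun t => Real.exp (extremal a b u σ γ t)) (Set.Icc a b) := by
    simp only [exp_extremal]
    rw [← intervalIntegrable_iff_integrableOn_Icc_of_le hab.le]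
    exact hi.const_mul _
  rw [expAverage, laverage_Icc_ofReal hab hi' fun t => (Real.exp_pos _).le]
  have e := iavg_const_add_mul 0 (Real.exp (u - σ * γ)) hab hi
  simp only [exp_extremal, zero_add] at e ⊢
  rw [e, iavg_comp_sub (fun t => Real.exp (σ * logBump (γ * (b - a)) t)), sub_self, iavg, sub_zero,
    h.2]
  have : 1 - σ ≠ 0 := by linarith
  congr 2
  field_simp

theorem measurable_extremal (a b u σ γ : ℝ) : Measurable (extremal a b u σ γ) := by
  unfold extremal logBump
  fun_prop

theorem expAverage_extremal_eq_top {a b u σ γ : ℝ} (hab : a < b) (hσ : 1 ≤ σ) (h0 : 0 < γ)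
    (h1 : γ ≤ 1) : expAverage a b (extremal a b u σ γ) = ∞ := by
  have hL : 0 < b - a := sub_pos.2 hab
  rw [expAverage, laverage_Icc_eq]
  suffices h : ∫⁻ t in Set.Icc a b, ENNReal.ofReal (Real.exp (extremal a b u σ γ t)) = ∞ by
    rw [h, ENNReal.top_div_of_ne_top ENNReal.ofReal_ne_top]
  by_contra h
  have hi : IntegrableOn (fun t => Real.exp (extremal a b u σ γ t)) (Set.Icc a b) := by
    refine ⟨(Real.measurable_exp.comp (measurable_extremal a b u σ γ)).aestronglyMeasurable, ?_⟩
    rw [hasFiniteIntegral_iff_ofReal (Eventually.of_forall fun t => (Real.exp_pos _).le)]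
    exact lt_top_iff_ne_top.2 h
  rw [← intervalIntegrable_iff_integrableOn_Icc_of_le hab.le] at hi
  simp only [exp_extremal] at hi
  have hi2 := (hi.const_mul (Real.exp (u - σ * γ))⁻¹).comp_add_right a
  simp only [inv_mul_cancel_left₀ (Real.exp_pos _).ne', add_sub_cancel_right, sub_self] at hi2
  exact not_intervalIntegrable_exp_logBump hσ (mul_pos h0 hL)
    (by nlinarith : γ * (b - a) ≤ b - a) hi2

/-! ### From bounded to general functions. -/

/-- The truncation of `x` to `[-n, n]`. -/
def truncate (n : ℕ) (x : ℝ) : ℝ := max (min x n) (-n)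

theorem lipschitzWith_truncate (n : ℕ) : LipschitzWith 1 (truncate n) :=
  (LipschitzWith.id.min_const _).max_const _

theorem abs_truncate_le (n : ℕ) (x : ℝ) : |truncate n x| ≤ n :=
  abs_le.2 ⟨le_max_right _ _, max_le (min_le_right _ _) (by linarith [n.cast_nonneg (α := ℝ)])⟩

theorem abs_truncate_le_abs (n : ℕ) (x : ℝ) : |truncate n x| ≤ |x| := by
  have hn : (0 : ℝ) ≤ n := n.cast_nonneg
  refine abs_le.2 ⟨?_, max_le ((min_le_left _ _).trans (le_abs_self x))
    (by linarith [abs_nonneg x])⟩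
  rcases le_total x n with h | h
  · exact (neg_abs_le x).trans ((min_eq_left h).symm.le.trans (le_max_left _ _))
  · refine le_trans ?_ ((min_eq_right h).symm.le.trans (le_max_left _ _))
    linarith [abs_nonneg x]

theorem tendsto_truncate (x : ℝ) : Tendsto (fun n => truncate n x) atTop (𝓝 x) := by
  refine tendsto_const_nhds.congr' ?_
  obtain ⟨m, hm⟩ := exists_nat_ge |x|
  filter_upwards [eventually_ge_atTop m] with n hn
  have : |x| ≤ n := hm.trans (Nat.cast_le.2 hn)
  rw [truncate, min_eq_left (abs_le.1 this).2, max_eq_left (abs_le.1 this).1]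

theorem exp_truncate_le (n : ℕ) (x : ℝ) :
    Real.exp (truncate n x) ≤ Real.exp x + Real.exp (-n) := by
  rcases max_choice (min x n) (-n) with h | h <;> rw [truncate, h]
  · linarith [Real.exp_le_exp.2 (min_le_left x (n : ℝ)), Real.exp_pos (-(n : ℝ))]
  · linarith [Real.exp_pos x]

theorem tendsto_iavg_of_dominated {f : ℕ → ℝ → ℝ} {g h : ℝ → ℝ} {c d : ℝ}
    (hm : ∀ n, IntervalIntegrable (f n) volume c d) (hg : IntervalIntegrable g volume c d)
    (hfg : ∀ n t, |f n t| ≤ g t) (hlim : ∀ t, Tendsto (fun n => f n t) atTop (𝓝 (h t))) :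
    Tendsto (fun n => iavg (f n) c d) atTop (𝓝 (iavg h c d)) :=
  (intervalIntegral.tendsto_integral_filter_of_dominated_convergence g
    (Eventually.of_forall fun n => (intervalIntegrable_iff.1 (hm n)).1)
    (Eventually.of_forall fun n => Eventually.of_forall fun t _ => hfg n t) hg
    (Eventually.of_forall fun t _ => hlim t)).const_mul _

section Bounds

variable {ε a b : ℝ} {φ : ℝ → ℝ}

theorem tendsto_bellmanPoint_truncate (hab : a < b) (hφ : VarianceBounded ε a b φ) :
    Tendsto (fun n : ℕ => bellmanPoint (fun t => truncate n (φ t)) a b) atTop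
      (𝓝 (bellmanPoint φ a b)) := by
  have hT := fun n : ℕ => hφ.comp_lipschitz (lipschitzWith_truncate n)
  refine Tendsto.prodMk_nhds ?_ ?_
  · exact tendsto_iavg_of_dominated
      (fun n => (hT n).intervalIntegrable le_rfl hab.le le_rfl)
      (hφ.intervalIntegrable le_rfl hab.le le_rfl).abs
      (fun n t => abs_truncate_le_abs n (φ t)) fun t => tendsto_truncate (φ t)
  · refine tendsto_iavg_of_dominated
      (fun n => (hT n).intervalIntegrable_sq le_rfl hab.le le_rfl)
      (hφ.intervalIntegrable_sq le_rfl hab.le le_rfl)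
      (fun n t => ?_) fun t => (tendsto_truncate (φ t)).pow 2
    rw [abs_of_nonneg (sq_nonneg _)]
    exact sq_le_sq.2 (abs_truncate_le_abs n (φ t))

theorem expAverage_of_bounded (hab : a < b) (hφ : VarianceBounded ε a b φ) {N : ℝ}
    (hN : ∀ t, |φ t| ≤ N) :
    expAverage a b φ = ENNReal.ofReal (iavg (fun t => Real.exp (φ t)) a b) := by
  refine laverage_Icc_ofReal hab ?_ fun t => (Real.exp_pos _).le
  refine Integrable.mono' (g := fun _ => Real.exp N) (integrableOn_const (by simp))
    (Real.continuous_exp.comp_aestronglyMeasurable hφ.integrable.1)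
    (Eventually.of_forall fun t => ?_)
  rw [Real.norm_of_nonneg (Real.exp_pos _).le]
  exact Real.exp_le_exp.2 (abs_le.1 (hN t)).2

/-- Three nested strips are needed: `ε` for the points, the midpoint for the segments, `δ` for the
explicit function. -/
theorem sq_half_add_lt {δ : ℝ} (hε : 0 ≤ ε) (hδ : ε < δ) :
    0 < (ε + δ) / 2 ∧ ε ^ 2 < ((ε + δ) / 2) ^ 2 ∧ ((ε + δ) / 2) ^ 2 < δ ^ 2 := by
  refine ⟨by linarith, ?_, ?_⟩ <;> nlinarith

/-- Truncations keep the variance bound and their points converge; Fatou's lemma transfers the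
bound, no integrability of `e^φ` being known beforehand. -/
theorem expAverage_le_of_lt {δ : ℝ} (hε : 0 ≤ ε) (hδ : ε < δ) (hδ1 : δ < 1) (hab : a < b)
    (hφ : VarianceBounded ε a b φ) :
    expAverage a b φ ≤ ENNReal.ofReal (explicitUpper δ (bellmanPoint φ a b)) := by
  obtain ⟨h0, h1, h2⟩ := sq_half_add_lt hε hδ
  have hT := fun n : ℕ => hφ.comp_lipschitz (lipschitzWith_truncate n)
  have hn : ∀ n : ℕ, expAverage a b (fun t => truncate n (φ t)) ≤
      ENNReal.ofReal (explicitUpper δ (bellmanPoint (fun t => truncate n (φ t)) a b)) := fun n => by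
    have := bellman_induction h0 h1 (continuous_explicitUpper δ)
      (locallyConcaveBelow_explicitUpper h2 hδ1) hab (hT n) fun t => abs_truncate_le n (φ t)
    simp only [explicitUpper_parabola (hε.trans hδ.le) hδ1] at this
    rw [expAverage_of_bounded hab (hT n) fun t => abs_truncate_le n (φ t)]
    exact ENNReal.ofReal_le_ofReal this
  have hlim := (ENNReal.continuous_ofReal.comp (continuous_explicitUpper δ)).continuousAt.tendsto.comp
    (tendsto_bellmanPoint_truncate hab hφ)
  have hfatou : expAverage a b φ ≤
      liminf (fun n : ℕ => expAverage a b (fun t => truncate n (φ t))) atTop := by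
    have e : ∀ t, ENNReal.ofReal (Real.exp (φ t)) =
        liminf (fun n : ℕ => ENNReal.ofReal (Real.exp (truncate n (φ t)))) atTop := fun t =>
      (((ENNReal.continuous_ofReal.comp Real.continuous_exp).tendsto _).comp
        (tendsto_truncate (φ t))).liminf_eq.symm
    unfold expAverage laverage
    simp only [e]
    refine lintegral_liminf_le' fun n => AEMeasurable.smul_measure ?_ _
    exact (Real.measurable_exp.comp_aemeasurable (hT n).integrable.1.aemeasurable).ennreal_ofReal
  exact hfatou.trans ((liminf_le_liminf (Eventually.of_forall hn)).trans hlim.liminf_eq.le)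

/-- Fatou goes the wrong way here. Instead, truncation raises the exponential by at most `e^(-n)`,
which also covers an infinite average. -/
theorem le_expAverage_of_lt {δ : ℝ} (hε : 0 ≤ ε) (hδ : ε < δ) (hab : a < b)
    (hφ : VarianceBounded ε a b φ) :
    ENNReal.ofReal (explicitLower δ (bellmanPoint φ a b)) ≤ expAverage a b φ := by
  obtain ⟨h0, h1, h2⟩ := sq_half_add_lt hε hδ
  have hT := fun n : ℕ => hφ.comp_lipschitz (lipschitzWith_truncate n)
  have hn : ∀ n : ℕ, ENNReal.ofReal
      (explicitLower δ (bellmanPoint (fun t => truncate n (φ t)) a b)) ≤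
        expAverage a b φ + ENNReal.ofReal (Real.exp (-n)) := fun n => by
    have := bellman_induction (B := fun x => -explicitLower δ x) h0 h1 (continuous_explicitLower δ).neg
      (locallyConcaveBelow_neg_explicitLower h2 (hε.trans hδ.le)) hab (hT n)
      fun t => abs_truncate_le n (φ t)
    simp only [explicitLower_parabola (hε.trans hδ.le)] at this
    have e : iavg (fun t => -Real.exp (truncate n (φ t))) a b =
        -iavg (fun t => Real.exp (truncate n (φ t))) a b := by
      rw [iavg, iavg, intervalIntegral.integral_neg]; ring
    rw [e, neg_le_neg_iff] at this
    refine (ENNReal.ofReal_le_ofReal this).trans ?_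
    rw [← expAverage_of_bounded hab (hT n) fun t => abs_truncate_le n (φ t), expAverage, expAverage,
      laverage_Icc_eq, laverage_Icc_eq]
    have hL : 0 < b - a := sub_pos.2 hab
    have hc : ENNReal.ofReal (Real.exp (-n)) =
        (∫⁻ _ in Set.Icc a b, ENNReal.ofReal (Real.exp (-n))) / ENNReal.ofReal (b - a) := by
      rw [setLIntegral_const, Real.volume_Icc, ENNReal.mul_div_cancel_right
        (by simpa using hab) ENNReal.ofReal_ne_top]
    rw [hc, ← ENNReal.add_div, ← lintegral_add_right _ measurable_const]
    refine ENNReal.div_le_div_right (lintegral_mono fun t => ?_) _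
    rw [← ENNReal.ofReal_add (Real.exp_pos _).le (Real.exp_pos _).le]
    exact ENNReal.ofReal_le_ofReal (exp_truncate_le n (φ t))
  have hlim := (ENNReal.continuous_ofReal.comp (continuous_explicitLower δ)).continuousAt.tendsto.comp
    (tendsto_bellmanPoint_truncate hab hφ)
  have hlim2 : Tendsto (fun n : ℕ => expAverage a b φ + ENNReal.ofReal (Real.exp (-n))) atTop
      (𝓝 (expAverage a b φ)) := by
    have h3 : Tendsto (fun n : ℕ => ENNReal.ofReal (Real.exp (-n))) atTop (𝓝 0) := by
      have := (ENNReal.continuous_ofReal.tendsto 0).comp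
        (Real.tendsto_exp_neg_atTop_nhds_zero.comp tendsto_natCast_atTop_atTop)
      rwa [ENNReal.ofReal_zero] at this
    simpa using h3.const_add (expAverage a b φ)
  exact le_of_tendsto_of_tendsto' hlim hlim2 hn

theorem expAverage_le (hε : 0 ≤ ε) (hε1 : ε < 1) (hab : a < b) (hφ : VarianceBounded ε a b φ) :
    expAverage a b φ ≤ ENNReal.ofReal (explicitUpper ε (bellmanPoint φ a b)) := by
  have hc : ContinuousAt (fun δ => explicitUpper δ (bellmanPoint φ a b)) ε := by
    have : 1 - ε ≠ 0 := by linarith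
    unfold explicitUpper
    fun_prop (disch := assumption)
  refine ge_of_tendsto ((ENNReal.continuous_ofReal.tendsto _).comp
    (hc.tendsto.mono_left nhdsWithin_le_nhds : Tendsto _ (𝓝[>] ε) _)) ?_
  filter_upwards [Ioo_mem_nhdsGT hε1] with δ hδ
  exact expAverage_le_of_lt hε hδ.1 hδ.2 hab hφ

theorem le_expAverage (hε : 0 ≤ ε) (hab : a < b) (hφ : VarianceBounded ε a b φ) :
    ENNReal.ofReal (explicitLower ε (bellmanPoint φ a b)) ≤ expAverage a b φ := by
  have hc : ContinuousAt (fun δ => explicitLower δ (bellmanPoint φ a b)) ε := by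
    have : 1 + ε ≠ 0 := by linarith
    unfold explicitLower
    fun_prop (disch := assumption)
  refine le_of_tendsto ((ENNReal.continuous_ofReal.tendsto _).comp
    (hc.tendsto.mono_left nhdsWithin_le_nhds : Tendsto _ (𝓝[>] ε) _)) ?_
  filter_upwards [self_mem_nhdsWithin] with δ hδ
  exact le_expAverage_of_lt hε hδ hab hφ

theorem expAverage_const (hab : a < b) (u : ℝ) :
    expAverage a b (fun _ => u) = ENNReal.ofReal (Real.exp u) := by
  rw [expAverage, laverage_Icc_ofReal hab (integrableOn_const (by simp))
    fun _ => (Real.exp_pos _).le, iavg_const _ hab]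

theorem const_mem_bellmanAdmissible (hε : 0 ≤ ε) (hab : a < b) (u : ℝ) :
    (fun _ => u) ∈ bellmanAdmissible ε a b (u, u ^ 2) := by
  rw [mem_bellmanAdmissible_iff hε hab]
  refine ⟨⟨integrableOn_const (by simp), integrableOn_const (by simp), fun c d _ h _ => ?_⟩,
    iavg_const _ hab, iavg_const _ hab⟩
  rw [iavg_const _ h, iavg_const _ h]
  linarith [sq_nonneg ε]

/-- A function whose variance over `[a, b]` vanishes is constant almost everywhere. -/
theorem expAverage_eq_of_variance_eq_zero (hε : 0 ≤ ε) (hab : a < b) {u : ℝ}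
    (hφ : φ ∈ bellmanAdmissible ε a b (u, u ^ 2)) :
    expAverage a b φ = ENNReal.ofReal (Real.exp u) := by
  rw [mem_bellmanAdmissible_iff hε hab] at hφ
  obtain ⟨hV, h1, h2⟩ := hφ
  have h := iavg_sub_sq u hab (hV.intervalIntegrable le_rfl hab.le le_rfl)
    (hV.intervalIntegrable_sq le_rfl hab.le le_rfl)
  simp only at h1 h2
  rw [h1, h2] at h
  have h0 : ∫ t in Set.Icc a b, (φ t - u) ^ 2 = 0 := by
    rw [integral_Icc_eq_integral_Ioc, ← intervalIntegral.integral_of_le hab.le]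
    have hL : (b - a)⁻¹ ≠ 0 := inv_ne_zero (sub_pos.2 hab).ne'
    refine (mul_eq_zero.1 (?_ : (b - a)⁻¹ * _ = 0)).resolve_left hL
    exact h.trans (by ring)
  rw [integral_eq_zero_iff_of_nonneg (fun t => sq_nonneg _)
    (integrableOn_sub_sq (by simp) u hV.integrable hV.integrable_sq)] at h0
  rw [← expAverage_const hab u]
  refine laverage_congr ?_
  filter_upwards [h0] with t ht
  have : φ t - u = 0 := by simpa using ht
  rw [sub_eq_zero.1 this]

/-- On the lower parabola the extremal parameter would be `γ = 0`, so constants replace the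
extremals; this also covers `ε = 0`. -/
theorem bellman_of_degenerate (hε : 0 ≤ ε) (hab : a < b) (u : ℝ) :
    bellmanUpper ε a b (u, u ^ 2) = ENNReal.ofReal (Real.exp u) ∧
      bellmanLower ε a b (u, u ^ 2) = ENNReal.ofReal (Real.exp u) := by
  have hmem := const_mem_bellmanAdmissible hε hab u
  refine ⟨le_antisymm ?_ ?_, le_antisymm ?_ ?_⟩
  · exact iSup₂_le fun φ hφ => (expAverage_eq_of_variance_eq_zero hε hab hφ).le
  · exact (expAverage_const hab u).symm.le.trans
      (le_iSup₂ (f := fun φ _ => expAverage a b φ) _ hmem)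
  · exact (iInf₂_le (f := fun φ _ => expAverage a b φ) _ hmem).trans (expAverage_const hab u).le
  · exact le_iInf₂ fun φ hφ => (expAverage_eq_of_variance_eq_zero hε hab hφ).symm.le

end Bounds

/-! ### Matching the bounds with the extremals. -/

theorem bellmanPoint_eq {ε a b : ℝ} (hε : 0 ≤ ε) (hab : a < b) {x : ℝ × ℝ} {φ : ℝ → ℝ}
    (h : φ ∈ bellmanAdmissible ε a b x) : VarianceBounded ε a b φ ∧ bellmanPoint φ a b = x := by
  rw [mem_bellmanAdmissible_iff hε hab] at h
  exact ⟨h.1, Prod.ext h.2.1 h.2.2⟩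

/-- The parameter of the extremal function attached to a point of the parabolic strip off the lower
boundary. -/
theorem exists_extremal_parameter {ε : ℝ} (hε : 0 ≤ ε) {x : ℝ × ℝ} (hx : x ∈ bellmanDomain ε)
    (hlt : x.1 ^ 2 < x.2) : ∃ γ, 0 < γ ∧ γ ≤ 1 ∧ 0 < ε ∧
      √(ε ^ 2 + x.1 ^ 2 - x.2) = ε - ε * γ ∧ x = (x.1, x.1 ^ 2 + ε ^ 2 * (1 - (1 - γ) ^ 2)) := by
  have hx2 : x.2 ≤ x.1 ^ 2 + ε ^ 2 := hx.2
  have hε0 : 0 < ε := by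
    refine lt_of_le_of_ne hε fun h => ?_
    subst h
    linarith
  set s := √(ε ^ 2 + x.1 ^ 2 - x.2) with hs
  have hs0 : 0 ≤ s := Real.sqrt_nonneg _
  have hs2 : s ^ 2 = ε ^ 2 + x.1 ^ 2 - x.2 := Real.sq_sqrt (by linarith)
  have hsε : s < ε := by nlinarith
  -- Solves `ε (1 - γ) = s`, which makes the variance of the extremal equal to `x.2 - x.1²`.
  refine ⟨1 - s / ε, ?_, ?_, hε0, ?_, Prod.ext rfl ?_⟩
  · rw [sub_pos, div_lt_one hε0]; exact hsε
  · linarith [div_nonneg hs0 hε]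
  · field_simp; ring
  · simp only
    field_simp
    linarith

theorem mainTheorem3 (a b : ℝ) (hab : a < b) (ε : ℝ) (hε : 0 ≤ ε)
    (x : ℝ × ℝ) (hx : x ∈ bellmanDomain ε) :
    (ε < 1 → bellmanUpper ε a b x = ENNReal.ofReal (explicitUpper ε x)) ∧
    (1 ≤ ε →
      (x.2 = x.1 ^ 2 → bellmanUpper ε a b x = ENNReal.ofReal (Real.exp x.1)) ∧
      (x.1 ^ 2 < x.2 → bellmanUpper ε a b x = ∞)) ∧
    bellmanLower ε a b x = ENNReal.ofReal (explicitLower ε x) := by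
  rcases eq_or_lt_of_le hx.1 with heq | hlt
  · obtain ⟨u, v⟩ := x
    simp only at heq
    subst heq
    obtain ⟨h1, h2⟩ := bellman_of_degenerate hε hab u
    refine ⟨fun hε1 => ?_, fun _ => ⟨fun _ => h1, fun h => absurd h (lt_irrefl _)⟩, ?_⟩
    · rw [h1, explicitUpper_parabola hε hε1]
    · rw [h2, explicitLower_parabola hε]
  · obtain ⟨γ, hγ0, hγ1, hε0, hs, hxe⟩ := exists_extremal_parameter hε hx hlt
    have hmem : ∀ σ, σ ^ 2 = ε ^ 2 → extremal a b x.1 σ γ ∈ bellmanAdmissible ε a b x :=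
      fun σ hσ => by
        have := extremal_mem (u := x.1) hε hab hσ hγ0 hγ1
        rwa [hσ, ← hxe] at this
    have hup : ∀ σ, σ ^ 2 = ε ^ 2 →
        expAverage a b (extremal a b x.1 σ γ) ≤ bellmanUpper ε a b x := fun σ hσ =>
      le_iSup₂ (f := fun φ _ => expAverage a b φ) _ (hmem σ hσ)
    refine ⟨fun hε1 => le_antisymm (iSup₂_le fun φ hφ => ?_) ?_, fun hε1 =>
      ⟨fun h => absurd h hlt.ne', fun _ => ?_⟩, le_antisymm ?_ (le_iInf₂ fun φ hφ => ?_)⟩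
    · obtain ⟨hV, hp⟩ := bellmanPoint_eq hε hab hφ
      rw [← hp]
      exact expAverage_le hε hε1 hab hV
    · refine le_trans (le_of_eq ?_) (hup ε rfl)
      rw [expAverage_extremal hab hε1 hγ0 hγ1, explicitUpper, hs]
      have h1 : 1 - ε ≠ 0 := by linarith
      have e : x.1 + (ε - ε * γ) - ε = x.1 - ε * γ := by ring
      rw [e]
      congr 1
      field_simp
      ring
    · exact top_le_iff.1 ((expAverage_extremal_eq_top hab hε1 hγ0 hγ1).symm.le.trans (hup ε rfl))
    · refine (iInf₂_le (f := fun φ _ => expAverage a b φ) _ (hmem (-ε) (by ring))).trans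
        (le_of_eq ?_)
      rw [expAverage_extremal hab (by linarith) hγ0 hγ1, explicitLower, hs]
      have h1 : 1 + ε ≠ 0 := by linarith
      have e : x.1 - (ε - ε * γ) + ε = x.1 - -ε * γ := by ring
      rw [e, sub_neg_eq_add]
      congr 1
      field_simp
      ring
    · obtain ⟨hV, hp⟩ := bellmanPoint_eq hε hab hφ
      rw [← hp]
      exact le_expAverage hε hab hV
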